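/- Fix a sequence $(a_i)_{i\in\mathbb N}$ of pairwise distinct points of $(-1,1)$ such that $S=\{a_i : i\in\mathbb N\}$ is dense in $(-1,1)$. A germ of a function at a point is called weakly smooth if, for every $p\in\mathbb N$, it is $C^p$ (on a neighbourhood that may depend on $p$). Let $\mathcal V$ be the real vector space of continuous functions $f\colon(-1,1)\to\mathbb R$ such that (i) the germ of $f$ at every $x\in(-1,1)\setminus S$ is weakly smooth; (ii) for every $p\in\mathbb N$ the germ of $f$ at $a_p$ is $C^p$; (iii) for every $a\in S$ and $p\ge 0$ the limits $f^{(p)}(a^-)=\lim_{x\to a^-}f^{(p)}(x)$ and $f^{(p)}(a^+)=\lim_{x\to a^+}f^{(p)}(x)$ exist. Equip $\mathcal V$ with the locally convex topology generated by the seminorms $$\|f\|_{K,p}=\sup\{|f^{(q)}(x)| : x\in K\setminus S,\ q\le p\},\qquad K\subset(-1,1)\text{ compact},\ p\in\mathbb N,$$ where the supremum of the empty set is $0$. For $f\in\mathcal V$, integers $n,k\ge 0$, $p\ge k$ and points $x=(x_1,\dots,x_n)$ of $(-1,1)\setminus S$, let $j_n^{p,k}f(x)$ be the tuple consisting of $f^{(q)}(x_i)$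 for $0\le q\le p$, $1\le i\le n$; of $f^{(q)}(a_i)$ for $0\le q\le i\le k$; and of $f^{(q)}(a_i^-)$ and $f^{(q)}(a_i^+)$ for $0\le i\le k$, $i<q\le p$. Call $f$ strongly transcendental if for all $n,k\in\mathbb N$ and all tuples $x=(x_1,\dots,x_n)$ of pairwise distinct points of $(-1,1)\setminus S$ there is $C\in\mathbb N$ such that for all integers $p\ge k$ $$\operatorname{trdeg}_{\mathbb Q}\bigl(x,a_0,\dots,a_k,j_n^{p,k}f(x)\bigr)\ \ge\ n(p+2)+(k+1)(2p+3)-\frac{(k+1)(k+2)}2-C. \qquad(*)$$ **Theorem.** The space $\mathcal V$ is complete, metrisable and locally convex. The set of strongly transcendental functions is dense in $\mathcal V$; indeed it contains a residual set (a countable intersection of dense open sets) on all of whose elements $(*)$ holds with $C=n+k+1$, for all $n$, $k$ and $x$ as above. If $f\in\mathcal V$ is strongly transcendental, then for every $a\in S$ the germ of $f$ at $a$ is not weakly smooth, and $f$ is nowhere smooth: it is not $C^\infty$ on any non-empty open subset of $(-1,1)$. -/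

import Mathlib

noncomputable section

namespace NowhereSmooth

open Set Filter Topology
open scoped ContDiff

/-- The open interval `(-1, 1)`, as a type. -/
abbrev I : Type := Set.Ioo (-1 : ℝ) 1

/-- The extension by `0` to the whole line of a function on `(-1, 1)`. It only serves to speak of
derivatives at points of `(-1, 1)`, which depend only on the germ of the function there. -/
def ext (f : I → ℝ) : ℝ → ℝ := Function.extend Subtype.val f 0

/-- `der f q` is the `q`-th derivative `f^{(q)}`, meaningful at points of `(-1, 1)` around which
`f` is `C^q`. -/
def der (f : I → ℝ) (q : ℕ) : ℝ → ℝ := iteratedDeriv q (ext f)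

/-- The one-sided limit `f^{(q)}(x⁻)`. -/
def derLeft (f : I → ℝ) (q : ℕ) (x : ℝ) : ℝ := limUnder (𝓝[<] x) (der f q)

/-- The one-sided limit `f^{(q)}(x⁺)`. -/
def derRight (f : I → ℝ) (q : ℕ) (x : ℝ) : ℝ := limUnder (𝓝[>] x) (der f q)

/-- The germ of `f` at `x` is `C^p`: it is `C^p` on some neighbourhood of `x`. -/
def GermC (f : I → ℝ) (p : ℕ) (x : I) : Prop := ContDiffAt ℝ p (ext f) x

/-- The germ of `f` at `x` is weakly smooth: it is `C^p` for every `p`, on a neighbourhood of `x`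
that is allowed to depend on `p`. -/
def GermWeaklySmooth (f : I → ℝ) (x : I) : Prop := ∀ p : ℕ, GermC f p x

/-- Membership in the space `𝓥` attached to the sequence `a`, whose range is `S`. -/
structure MemV (a : ℕ → I) (f : I → ℝ) : Prop where
  continuous : Continuous f
  weaklySmooth : ∀ x : I, x ∉ range a → GermWeaklySmooth f x
  contDiff : ∀ p : ℕ, GermC f p (a p)
  limLeft : ∀ x ∈ range a, ∀ p : ℕ, ∃ l : ℝ, Tendsto (der f p) (𝓝[<] (x : ℝ)) (𝓝 l)
  limRight : ∀ x ∈ range a, ∀ p : ℕ, ∃ l : ℝ, Tendsto (der f p) (𝓝[>] (x : ℝ)) (𝓝 l)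

theorem ext_coe (f : I → ℝ) (x : I) : ext f x = f x :=
  Subtype.val_injective.extend_apply f 0 x

theorem ext_add (f g : I → ℝ) : ext (f + g) = ext f + ext g :=
  (Function.ExtendByZero.linearMap ℝ (Subtype.val : I → ℝ)).map_add f g

theorem ext_smul (c : ℝ) (f : I → ℝ) : ext (c • f) = c • ext f :=
  (Function.ExtendByZero.linearMap ℝ (Subtype.val : I → ℝ)).map_smul c f

theorem ext_zero : ext 0 = 0 :=
  (Function.ExtendByZero.linearMap ℝ (Subtype.val : I → ℝ)).map_zero

theorem der_smul (c : ℝ) (f : I → ℝ) (q : ℕ) (x : ℝ) : der (c • f) q x = c * der f q x := by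
  simp only [der, ext_smul]
  exact iteratedDeriv_const_smul_field c (ext f)

theorem der_add {f g : I → ℝ} {q : ℕ} {x : I} (hf : GermC f q x) (hg : GermC g q x) :
    der (f + g) q x = der f q x + der g q x := by
  simp only [der, ext_add]
  exact iteratedDeriv_add hf hg

theorem MemV.germC {a : ℕ → I} {f : I → ℝ} (hf : MemV a f) {q : ℕ} {x : I}
    (hx : ∀ j < q, a j ≠ x) : GermC f q x := by
  by_cases h : x ∈ range a
  · obtain ⟨j, rfl⟩ := h
    have hj : q ≤ j := by
      by_contra hlt
      exact hx j (by omega) rfl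
    exact (hf.contDiff j).of_le (by exact_mod_cast hj)
  · exact hf.weaklySmooth x h q

/-- In a punctured neighbourhood of a point, elements of `𝓥` have `q`-th derivatives. -/
theorem eventually_avoid (a : ℕ → I) (q : ℕ) (x : I) :
    ∀ᶠ y in 𝓝[≠] (x : ℝ), ∃ z : I, (z : ℝ) = y ∧ ∀ j < q, a j ≠ z := by
  have h1 : ∀ᶠ y in 𝓝[≠] (x : ℝ), y ∈ Set.Ioo (-1 : ℝ) 1 :=
    nhdsWithin_le_nhds (Ioo_mem_nhds x.2.1 x.2.2)
  have h2 : ∀ᶠ y in 𝓝[≠] (x : ℝ), ∀ j ∈ Finset.range q, (a j : ℝ) ≠ y := by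
    rw [Filter.eventually_all_finset]
    intro j _
    by_cases hj : (a j : ℝ) = x
    · filter_upwards [self_mem_nhdsWithin] with y hy
      rw [hj]
      exact fun h => hy h.symm
    · filter_upwards [nhdsWithin_le_nhds (isOpen_ne.mem_nhds (Ne.symm hj))] with y hy
      exact Ne.symm hy
  filter_upwards [h1, h2] with y hy1 hy2
  exact ⟨⟨y, hy1⟩, rfl, fun j hj h => hy2 j (Finset.mem_range.2 hj) (by rw [h])⟩

theorem der_add_eventually {a : ℕ → I} {f g : I → ℝ} (hf : MemV a f) (hg : MemV a g) (q : ℕ)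
    (x : I) : ∀ᶠ y in 𝓝[≠] (x : ℝ), der f q y + der g q y = der (f + g) q y := by
  filter_upwards [eventually_avoid a q x] with y ⟨z, hz, hj⟩
  rw [← hz, der_add (hf.germC hj) (hg.germC hj)]

theorem MemV.zero (a : ℕ → I) : MemV a 0 := by
  have hd : ∀ p, der 0 p = fun _ => (0 : ℝ) := fun p => by
    funext x
    simpa using der_smul 0 0 p x
  have hc : ∀ p x, GermC 0 p x := fun p x => by
    unfold GermC
    rw [ext_zero]
    exact contDiffAt_const
  refine ⟨continuous_const, fun x _ p => hc p x, fun p => hc p _, fun x _ p => ⟨0, ?_⟩,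
    fun x _ p => ⟨0, ?_⟩⟩ <;> rw [hd] <;> exact tendsto_const_nhds

theorem MemV.add {a : ℕ → I} {f g : I → ℝ} (hf : MemV a f) (hg : MemV a g) :
    MemV a (f + g) := by
  have hc : ∀ p x, GermC f p x → GermC g p x → GermC (f + g) p x := fun p x h1 h2 => by
    unfold GermC
    rw [ext_add]
    exact ContDiffAt.add h1 h2
  refine ⟨hf.continuous.add hg.continuous,
    fun x hx p => hc p x (hf.weaklySmooth x hx p) (hg.weaklySmooth x hx p),
    fun p => hc p _ (hf.contDiff p) (hg.contDiff p), fun x hx p => ?_, fun x hx p => ?_⟩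
  · obtain ⟨l, hl⟩ := hf.limLeft x hx p
    obtain ⟨m, hm⟩ := hg.limLeft x hx p
    exact ⟨l + m, (hl.add hm).congr'
      ((der_add_eventually hf hg p x).filter_mono (nhdsWithin_mono _ fun y hy => ne_of_lt hy))⟩
  · obtain ⟨l, hl⟩ := hf.limRight x hx p
    obtain ⟨m, hm⟩ := hg.limRight x hx p
    exact ⟨l + m, (hl.add hm).congr'
      ((der_add_eventually hf hg p x).filter_mono (nhdsWithin_mono _ fun y hy => ne_of_gt hy))⟩

theorem MemV.smul {a : ℕ → I} {f : I → ℝ} (c : ℝ) (hf : MemV a f) : MemV a (c • f) := by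
  have hc : ∀ p x, GermC f p x → GermC (c • f) p x := fun p x h1 => by
    unfold GermC
    rw [ext_smul]
    exact ContDiffAt.const_smul c h1
  have hd : ∀ p, der (c • f) p = fun x => c * der f p x := fun p => funext (der_smul c f p)
  refine ⟨hf.continuous.const_smul c, fun x hx p => hc p x (hf.weaklySmooth x hx p),
    fun p => hc p _ (hf.contDiff p), fun x hx p => ?_, fun x hx p => ?_⟩
  · obtain ⟨l, hl⟩ := hf.limLeft x hx p
    exact ⟨c * l, by rw [hd]; exact hl.const_mul c⟩
  · obtain ⟨l, hl⟩ := hf.limRight x hx p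
    exact ⟨c * l, by rw [hd]; exact hl.const_mul c⟩

/-- The functions in `𝓥`, as a linear subspace of all functions on `(-1, 1)`. -/
def submoduleV (a : ℕ → I) : Submodule ℝ (I → ℝ) where
  carrier := {f | MemV a f}
  add_mem' := MemV.add
  zero_mem' := MemV.zero a
  smul_mem' c _ := MemV.smul c

/-- The vector space `𝓥`. It is a type of its own, so that it does not inherit the topology of
pointwise convergence. -/
def V (a : ℕ → I) : Type := submoduleV a

instance (a : ℕ → I) : AddCommGroup (V a) := inferInstanceAs (AddCommGroup (submoduleV a))

instance (a : ℕ → I) : Module ℝ (V a) := inferInstanceAs (Module ℝ (submoduleV a))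

/-- The function underlying an element of `𝓥`. -/
def V.fn {a : ℕ → I} (f : V a) : I → ℝ := Subtype.val (p := fun g => g ∈ submoduleV a) f

theorem V.mem {a : ℕ → I} (f : V a) : MemV a f.fn :=
  Subtype.property (p := fun g => g ∈ submoduleV a) f

theorem V.fn_add {a : ℕ → I} (f g : V a) : (f + g).fn = f.fn + g.fn := rfl

theorem V.fn_smul {a : ℕ → I} (c : ℝ) (f : V a) : (c • f).fn = c • f.fn := rfl

/-- The values `|f^{(q)}(x)|` for `x ∈ K \ S` and `q ≤ p`. -/
def absValues {a : ℕ → I} (K : TopologicalSpace.Compacts I) (p : ℕ) (f : V a) : Set ℝ :=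
  {y | ∃ x : I, x ∈ K ∧ x ∉ range a ∧ ∃ q ≤ p, y = |der f.fn q x|}

theorem locally_bounded {a : ℕ → I} (f : V a) (q : ℕ) (x : I) :
    ∃ M : ℝ, ∀ᶠ y in 𝓝 x, y ∉ range a → |der f.fn q y| ≤ M := by
  by_cases hx : x ∈ range a
  · obtain ⟨l, hl⟩ := f.mem.limLeft x hx q
    obtain ⟨m, hm⟩ := f.mem.limRight x hx q
    have hl' := hl.abs.eventually (gt_mem_nhds (lt_add_one |l|))
    have hm' := hm.abs.eventually (gt_mem_nhds (lt_add_one |m|))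
    rw [eventually_nhdsWithin_iff] at hl' hm'
    refine ⟨max (|l| + 1) (|m| + 1), ?_⟩
    filter_upwards [continuous_subtype_val.continuousAt.eventually hl',
      continuous_subtype_val.continuousAt.eventually hm'] with y h1 h2 hy
    rcases lt_trichotomy (y : ℝ) x with h | h | h
    · exact (h1 h).le.trans (le_max_left _ _)
    · exact absurd (Subtype.ext h ▸ hx) hy
    · exact (h2 h).le.trans (le_max_right _ _)
  · have h : ContDiffAt ℝ q (ext f.fn) x := f.mem.weaklySmooth x hx q
    have hc : ContinuousAt (der f.fn q) x := by
      unfold der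
      rw [iteratedDeriv_eq_equiv_comp]
      exact (LinearIsometryEquiv.continuous _).continuousAt.comp
        (h.continuousAt_iteratedFDeriv le_rfl)
    refine ⟨|der f.fn q x| + 1, ?_⟩
    have h2 := hc.abs.eventually (gt_mem_nhds (lt_add_one |der f.fn q x|))
    filter_upwards [continuous_subtype_val.continuousAt.eventually h2] with y hy _
    exact hy.le

theorem absValues_bddAbove {a : ℕ → I} (K : TopologicalSpace.Compacts I) (p : ℕ) (f : V a) :
    BddAbove (absValues K p f) := by
  have key : ∀ q, ∃ M : ℝ, ∀ x ∈ (K : Set I), x ∉ range a → |der f.fn q x| ≤ M := by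
    intro q
    refine K.isCompact.induction_on (p := fun s => ∃ M : ℝ, ∀ x ∈ s, x ∉ range a →
      |der f.fn q x| ≤ M) ⟨0, by simp⟩ ?_ ?_ ?_
    · rintro s t hst ⟨M, hM⟩
      exact ⟨M, fun x hx => hM x (hst hx)⟩
    · rintro s t ⟨M, hM⟩ ⟨N, hN⟩
      refine ⟨max M N, fun x hx hxa => ?_⟩
      rcases hx with hx | hx
      · exact (hM x hx hxa).trans (le_max_left _ _)
      · exact (hN x hx hxa).trans (le_max_right _ _)
    · intro x _
      obtain ⟨M, hM⟩ := locally_bounded f q x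
      exact ⟨_, nhdsWithin_le_nhds hM, M, fun y hy => hy⟩
  choose M hM using key
  refine ⟨∑ q ∈ Finset.range (p + 1), |M q|, ?_⟩
  rintro y ⟨x, hxK, hxa, q, hq, rfl⟩
  exact (hM q x hxK hxa).trans ((le_abs_self _).trans
    (Finset.single_le_sum (f := fun q => |M q|) (fun _ _ => abs_nonneg _)
      (Finset.mem_range.2 (Nat.lt_succ_of_le hq))))

theorem absValues_nonneg {a : ℕ → I} (K : TopologicalSpace.Compacts I) (p : ℕ) (f : V a) :
    ∀ y ∈ absValues K p f, 0 ≤ y := by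
  rintro y ⟨x, -, -, q, -, rfl⟩
  exact abs_nonneg _

/-- The seminorm `‖f‖_{K, p} = sup {|f^{(q)}(x)| : x ∈ K \ S, q ≤ p}` (`0` when `K ⊆ S`). -/
def seminormV (a : ℕ → I) (K : TopologicalSpace.Compacts I) (p : ℕ) : Seminorm ℝ (V a) :=
  Seminorm.ofSMulLE (fun f => sSup (absValues K p f))
    (le_antisymm
      (Real.sSup_le (by
        rintro y ⟨x, -, -, q, -, rfl⟩
        have h : (0 : V a).fn = (0 : ℝ) • (0 : V a).fn := by
          rw [← V.fn_smul, zero_smul]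
        rw [h, der_smul]
        simp) le_rfl)
      (Real.sSup_nonneg (absValues_nonneg K p 0)))
    (fun f g => by
      refine Real.sSup_le ?_ (add_nonneg (Real.sSup_nonneg (absValues_nonneg K p f))
        (Real.sSup_nonneg (absValues_nonneg K p g)))
      rintro y ⟨x, hxK, hxa, q, hq, rfl⟩
      rw [V.fn_add, der_add (f.mem.weaklySmooth x hxa q) (g.mem.weaklySmooth x hxa q)]
      exact (abs_add_le _ _).trans (add_le_add
        (le_csSup (absValues_bddAbove K p f) ⟨x, hxK, hxa, q, hq, rfl⟩)
        (le_csSup (absValues_bddAbove K p g) ⟨x, hxK, hxa, q, hq, rfl⟩)))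
    (fun c f => by
      refine Real.sSup_le ?_ (mul_nonneg (norm_nonneg c)
        (Real.sSup_nonneg (absValues_nonneg K p f)))
      rintro y ⟨x, hxK, hxa, q, hq, rfl⟩
      rw [V.fn_smul, der_smul, abs_mul, Real.norm_eq_abs]
      exact mul_le_mul_of_nonneg_left
        (le_csSup (absValues_bddAbove K p f) ⟨x, hxK, hxa, q, hq, rfl⟩) (abs_nonneg c))

/-- The family of all the seminorms `‖·‖_{K, p}`. -/
def seminormsV (a : ℕ → I) : SeminormFamily ℝ (V a) (TopologicalSpace.Compacts I × ℕ) :=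
  fun i => seminormV a i.1 i.2

/-- `𝓥` carries the locally convex topology generated by the seminorms `‖·‖_{K, p}`, and the
uniform structure of this topological vector space. -/
instance (a : ℕ → I) : UniformSpace (V a) :=
  (seminormsV a).addGroupFilterBasis.uniformSpace

theorem withSeminormsV (a : ℕ → I) : WithSeminorms (seminormsV a) := ⟨rfl⟩

instance (a : ℕ → I) : IsUniformAddGroup (V a) :=
  (seminormsV a).addGroupFilterBasis.isUniformAddGroup

instance (a : ℕ → I) : ContinuousSMul ℝ (V a) := (withSeminormsV a).continuousSMul

/-- The set of entries of the tuple `j_n^{p,k} f (x)`. -/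
def jet {a : ℕ → I} (f : V a) (n p k : ℕ) (x : Fin n → I) : Set ℝ :=
  {y | ∃ i : Fin n, ∃ q ≤ p, y = der f.fn q (x i)} ∪
  {y | ∃ i ≤ k, ∃ q ≤ i, y = der f.fn q (a i)} ∪
  {y | ∃ i ≤ k, ∃ q, i < q ∧ q ≤ p ∧ (y = derLeft f.fn q (a i) ∨ y = derRight f.fn q (a i))}

/-- The transcendence degree over `ℚ` of (the field generated by) a set of real numbers. -/
def trdegQ (T : Set ℝ) : Cardinal := Algebra.trdeg ℚ (IntermediateField.adjoin ℚ T)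

/-- The set of entries of the tuple `(x, a_0, …, a_k, j_n^{p,k} f (x))`. -/
def fullJet {a : ℕ → I} (f : V a) (n p k : ℕ) (x : Fin n → I) : Set ℝ :=
  {y | ∃ i : Fin n, y = x i} ∪ {y | ∃ i ≤ k, y = a i} ∪ jet f n p k x

/-- For all `p ≥ k`, the transcendence degree of `(x, a_0, …, a_k, j_n^{p,k} f (x))` is at least
`n(p+2) + (k+1)(2p+3) - (k+1)(k+2)/2 - C`. The negative terms are moved to the other side. -/
def TrdegBound {a : ℕ → I} (f : V a) (n k : ℕ) (x : Fin n → I) (C : ℕ) : Prop :=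
  ∀ p : ℕ, k ≤ p →
    ((n * (p + 2) + (k + 1) * (2 * p + 3) : ℕ) : Cardinal) ≤
      trdegQ (fullJet f n p k x) + (((k + 1) * (k + 2) / 2 + C : ℕ) : Cardinal)

/-- Strongly transcendental elements of `𝓥`. -/
def StronglyTranscendental {a : ℕ → I} (f : V a) : Prop :=
  ∀ (n k : ℕ) (x : Fin n → I), (∀ i, x i ∉ range a) → Function.Injective x →
    ∃ C : ℕ, TrdegBound f n k x C

/-- A residual set: a countable intersection of dense open sets. -/
def IsResidualSet {X : Type*} [TopologicalSpace X] (R : Set X) : Prop :=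
  ∃ U : ℕ → Set X, (∀ m, IsOpen (U m) ∧ Dense (U m)) ∧ R = ⋂ m, U m

/-- `f` is nowhere smooth: there is no non-empty open subset of `(-1, 1)` on which it is
`C^∞`. -/
def IsNowhereSmooth (f : I → ℝ) : Prop :=
  ∀ U : Set ℝ, IsOpen U → U.Nonempty → U ⊆ Set.Ioo (-1 : ℝ) 1 → ¬ ContDiffOn ℝ ∞ (ext f) U

end NowhereSmooth

end

noncomputable section

namespace NowhereSmooth

open Set Filter Topology
open scoped ContDiff

variable {a : ℕ → I}

/-! The core is a Baire category argument in the complete metrisable space `V a`. Fix `n`, `k`, `p`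
and let `N` be the cardinality of `SplineIndex n p k`. If a jet has no `N` algebraically independent
entries, then every selection `s` of `N` entries satisfies a nonzero rational relation `P s`. There
are only countably many families `P`, so it is enough that, for each family and each member of a
compact covering of the space of point tuples, `jetAvoiding` is open (`isOpen_jetAvoiding`, by
compactness) and dense (`dense_jetAvoiding`).

Density asks for one small perturbation that serves all tuples `x` at once. Splines, that is
polynomials plus truncated powers, are dense: truncated powers cancel the jumps of finitely many
derivatives, and Weierstrass approximation in `C^m` does the rest (`dense_splines`). A spline `g` is
defined over a countable field `K` that contains `S`. Add to it a small combination of `N` powers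
and truncated powers whose coefficients `c` are algebraically independent over `K`. Whatever `x` is,
`c` is rational over `K` in `x` and the jet (`coeff_mem_of_jetFun_mem`): jumps give the coefficients
of the truncated powers, and Hermite interpolation at the `x i` and at `a 0, …, a k` gives the
others. Hence `N` of these entries are independent. Putting `x` among the data is what avoids
exceptional tuples; the loss `n + k + 1` is the number of base points.

Nowhere smoothness is a count: if the germ at `a k` were weakly smooth, the left and right limits
there would agree, and the number of distinct jet entries would grow too slowly in `p`. -/

/-! ### Calculus: removable singularities, uniform limits, approximation in `C^P`. -/

theorem continuousAt_iteratedDeriv {F : ℝ → ℝ} {q : ℕ} {x : ℝ} (h : ContDiffAt ℝ q F x) :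
    ContinuousAt (iteratedDeriv q F) x := by
  rw [iteratedDeriv_eq_equiv_comp]
  exact (LinearIsometryEquiv.continuous _).continuousAt.comp
    (h.continuousAt_iteratedFDeriv le_rfl)

theorem contDiffAt_succ_of_deriv {F : ℝ → ℝ} {P : ℕ} {x : ℝ}
    (hd : ∀ᶠ y in 𝓝 x, DifferentiableAt ℝ F y) (h : ContDiffAt ℝ P (deriv F) x) :
    ContDiffAt ℝ (P + 1 : ℕ) F x := by
  obtain ⟨u, hu2, hu, hxu⟩ := eventually_nhds_iff.1 ((h.eventually (by simp)).and hd)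
  have : ContDiffOn ℝ (P + 1) F u := by
    rw [contDiffOn_succ_iff_deriv_of_isOpen hu]
    exact ⟨fun y hy => (hu2 y hy).2.differentiableWithinAt, by simp,
      fun y hy => (hu2 y hy).1.contDiffWithinAt⟩
  exact_mod_cast this.contDiffAt (hu.mem_nhds hxu)

theorem contDiffAt_deriv {F : ℝ → ℝ} {P : ℕ} {x : ℝ} (h : ContDiffAt ℝ (P + 1 : ℕ) F x) :
    ContDiffAt ℝ P (deriv F) x := by
  have h1 := ContDiffAt.fderiv_right_succ (n := P) (by exact_mod_cast h)
  exact h1.clm_apply contDiffAt_const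

/-- A continuous function whose derivative has a limit at `x` is differentiable at `x` with that
limit as derivative; induct on the order. This glues the two sides of a point of `S` when there is
no jump. -/
theorem contDiffAt_of_punctured {P : ℕ} {F : ℝ → ℝ} {x : ℝ} (hc : ContinuousAt F x)
    (hF : ∀ᶠ y in 𝓝[≠] x, ContDiffAt ℝ P F y)
    (hl : ∀ q ≤ P, ∃ l, Tendsto (iteratedDeriv q F) (𝓝[≠] x) (𝓝 l)) :
    ContDiffAt ℝ P F x := by
  induction P generalizing F with
  | zero =>
    have h : ∀ᶠ y in 𝓝 x, ContinuousAt F y := by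
      rw [eventually_nhdsWithin_iff] at hF
      filter_upwards [hF] with y hy
      by_cases h : y = x
      · rwa [h]
      · exact (hy h).continuousAt
    obtain ⟨u, hu, h2⟩ := h.exists_mem
    exact contDiffAt_zero.2 ⟨u, hu, fun y hy => (h2 y hy).continuousWithinAt⟩
  | succ P ih =>
    obtain ⟨l, hl1⟩ := hl 1 (by omega)
    rw [iteratedDeriv_one] at hl1
    have hd : ∀ᶠ y in 𝓝[≠] x, DifferentiableAt ℝ F y :=
      hF.mono fun y hy => hy.differentiableAt (by simp)
    rw [eventually_nhdsWithin_iff, Metric.eventually_nhds_iff] at hd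
    obtain ⟨ε, hε, hd⟩ := hd
    have hx : HasDerivAt F l x := by
      rw [← hasDerivWithinAt_univ, ← Iic_union_Ici (a := x)]
      refine HasDerivWithinAt.union ?_ ?_
      · refine hasDerivWithinAt_Iic_of_tendsto_deriv (s := Ioo (x - ε) x) (fun y hy =>
          (hd (by rw [Real.dist_eq, abs_lt]; constructor <;> linarith [hy.1, hy.2])
            (ne_of_lt hy.2)).differentiableWithinAt) hc.continuousWithinAt
          (Ioo_mem_nhdsLT (by linarith)) (hl1.mono_left (nhdsWithin_mono _ fun y hy => ne_of_lt hy))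
      · refine hasDerivWithinAt_Ici_of_tendsto_deriv (s := Ioo x (x + ε)) (fun y hy =>
          (hd (by rw [Real.dist_eq, abs_lt]; constructor <;> linarith [hy.1, hy.2])
            (ne_of_gt hy.1)).differentiableWithinAt) hc.continuousWithinAt
          (Ioo_mem_nhdsGT (by linarith)) (hl1.mono_left (nhdsWithin_mono _ fun y hy => ne_of_gt hy))
    refine contDiffAt_succ_of_deriv ?_ (ih ?_ ?_ ?_)
    · rw [Metric.eventually_nhds_iff]
      refine ⟨ε, hε, fun y hy => ?_⟩
      by_cases h : y = x
      · exact h ▸ hx.differentiableAt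
      · exact hd hy h
    · rw [continuousAt_iff_punctured_nhds, hx.deriv]
      exact hl1
    · exact hF.mono fun y hy => contDiffAt_deriv hy
    · intro q hq
      obtain ⟨m, hm⟩ := hl (q + 1) (by omega)
      exact ⟨m, by rwa [iteratedDeriv_succ'] at hm⟩

/-- Uniform limits of derivatives are derivatives of uniform limits. -/
theorem contDiffOn_of_tendstoUniformlyOn {P : ℕ} {F : ℕ → ℝ → ℝ} {D : ℕ → ℝ → ℝ} {s : Set ℝ}
    (hs : IsOpen s) (hF : ∀ j, ContDiffOn ℝ P (F j) s)
    (h : ∀ q ≤ P, TendstoUniformlyOn (fun j => iteratedDeriv q (F j)) (D q) atTop s) :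
    ContDiffOn ℝ P (D 0) s ∧ ∀ q ≤ P, ∀ x ∈ s, iteratedDeriv q (D 0) x = D q x := by
  induction P generalizing F D with
  | zero =>
    refine ⟨contDiffOn_zero.2 ((h 0 le_rfl).continuousOn
      (Frequently.of_forall fun j => by simpa using (hF j).continuousOn)), ?_⟩
    intro q hq x _
    obtain rfl : q = 0 := by omega
    simp
  | succ P ih =>
    have hd : ∀ x ∈ s, HasDerivAt (D 0) (D 1 x) x := by
      intro x hx
      refine hasDerivAt_of_tendstoUniformlyOn (l := atTop) (f := F)
        (f' := fun j => iteratedDeriv 1 (F j)) hs (h 1 (by omega)) ?_ ?_ hx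
      · refine Eventually.of_forall fun j y hy => ?_
        rw [iteratedDeriv_one]
        exact (((hF j).contDiffAt (hs.mem_nhds hy)).differentiableAt (by simp)).hasDerivAt
      · intro y hy
        simpa using (h 0 (by omega)).tendsto_at hy
    obtain ⟨h1, h2⟩ := ih (F := fun j => deriv (F j)) (D := fun q => D (q + 1))
      (fun j y hy => (contDiffAt_deriv ((hF j).contDiffAt (hs.mem_nhds hy))).contDiffWithinAt)
      (fun q hq => by simpa [iteratedDeriv_succ'] using h (q + 1) (by omega))
    have heq : ∀ x ∈ s, deriv (D 0) =ᶠ[𝓝 x] D 1 := fun x hx => by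
      filter_upwards [hs.mem_nhds hx] with y hy using (hd y hy).deriv
    refine ⟨?_, ?_⟩
    · push_cast
      rw [contDiffOn_succ_iff_deriv_of_isOpen hs]
      exact ⟨fun y hy => (hd y hy).differentiableAt.differentiableWithinAt, by simp,
        h1.congr fun y hy => (hd y hy).deriv⟩
    · rintro (_ | q) hq x hx
      · simp
      · rw [iteratedDeriv_succ', (heq x hx).iteratedDeriv_eq, h2 q (by omega) x hx]

theorem exists_derivative_eq (Q : Polynomial ℝ) : ∃ R : Polynomial ℝ, R.derivative = Q := by
  induction Q using Polynomial.induction_on' with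
  | add p q hp hq =>
    obtain ⟨R, rfl⟩ := hp
    obtain ⟨T, rfl⟩ := hq
    exact ⟨R + T, by simp⟩
  | monomial n c =>
    refine ⟨Polynomial.monomial (n + 1) (c / (n + 1)), ?_⟩
    rw [Polynomial.derivative_monomial]
    congr 1
    push_cast
    field_simp

/-- Weierstrass approximation in `C^P`. -/
theorem exists_polynomial_near_iteratedDeriv {P : ℕ} {F : ℝ → ℝ} {α β : ℝ} (hαβ : α ≤ β)
    (hF : ∀ x ∈ Icc α β, ContDiffAt ℝ P F x) {ε : ℝ} (hε : 0 < ε) :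
    ∃ Q : Polynomial ℝ, ∀ q ≤ P, ∀ x ∈ Icc α β,
      |(Polynomial.derivative^[q] Q).eval x - iteratedDeriv q F x| < ε := by
  induction P generalizing F ε with
  | zero =>
    obtain ⟨Q, hQ⟩ := exists_polynomial_near_of_continuousOn α β F
      (fun x hx => (hF x hx).continuousAt.continuousWithinAt) ε hε
    refine ⟨Q, fun q hq x hx => ?_⟩
    obtain rfl : q = 0 := by omega
    simpa using hQ x hx
  | succ P ih =>
    have hpos : 0 < β - α + 1 := by linarith
    -- Approximate `F'` and integrate, matching the value of `F` at `α`. The second bound absorbs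
    -- the length of the interval; the `+ 1` makes the denominator positive and the final inequality
    -- strict.
    obtain ⟨Q, hQ⟩ := ih (F := deriv F) (fun x hx => contDiffAt_deriv (hF x hx))
      (ε := min ε (ε / (β - α + 1))) (by positivity)
    obtain ⟨R, rfl⟩ := exists_derivative_eq Q
    set T := R + Polynomial.C (F α - R.eval α) with hT
    have hTd : T.derivative = R.derivative := by simp [hT]
    refine ⟨T, ?_⟩
    rintro (_ | q) hq x hx
    · have := Convex.norm_image_sub_le_of_norm_hasDerivWithin_le (𝕜 := ℝ) (s := Icc α β)
        (f := fun y => T.eval y - F y) (f' := fun y => R.derivative.eval y - deriv F y)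
        (C := ε / (β - α + 1)) (x := α) (y := x) (fun y hy => by
          refine HasDerivAt.hasDerivWithinAt (HasDerivAt.sub ?_ ?_)
          · rw [← hTd]; exact T.hasDerivAt y
          · exact ((hF y hy).differentiableAt (by simp)).hasDerivAt)
        (fun y hy => by
          have := hQ 0 (by omega) y hy
          simp only [Function.iterate_zero, id, iteratedDeriv_zero] at this
          exact (this.le.trans (min_le_right _ _))) (convex_Icc _ _) ⟨le_rfl, hαβ⟩ hx
      have h0 : T.eval α - F α = 0 := by simp [hT]
      rw [h0, sub_zero, Real.norm_eq_abs, Real.norm_eq_abs,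
        abs_of_nonneg (sub_nonneg.2 hx.1)] at this
      simp only [Function.iterate_zero, id, iteratedDeriv_zero]
      refine this.trans_lt ?_
      rw [div_mul_eq_mul_div, div_lt_iff₀ hpos]
      exact mul_lt_mul_of_pos_left (by linarith [hx.2]) hε
    · rw [Function.iterate_succ_apply, hTd, iteratedDeriv_succ']
      exact (hQ q (by omega) x hx).trans_le (min_le_left _ _)

/-! ### Elements of `V a`, their derivatives and one-sided limits. -/

theorem V.ext {f g : V a} (h : ∀ x, f.fn x = g.fn x) : f = g :=
  Subtype.ext (funext h)

theorem V.fn_sub (f g : V a) : (f - g).fn = f.fn - g.fn := rfl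

theorem V.fn_zero : (0 : V a).fn = 0 := rfl

/-- Bundling a function of `𝓥`. -/
def MemV.toV {f : I → ℝ} (hf : MemV a f) : V a := ⟨f, hf⟩

theorem MemV.toV_fn {f : I → ℝ} (hf : MemV a f) : hf.toV.fn = f := rfl

theorem der_zero_apply (f : I → ℝ) (x : I) : der f 0 x = f x := by
  simp [der, ext_coe]

theorem ext_sub (f g : I → ℝ) : ext (f - g) = ext f - ext g :=
  (Function.ExtendByZero.linearMap ℝ (Subtype.val : I → ℝ)).map_sub f g

theorem der_sub {f g : I → ℝ} {q : ℕ} {x : I} (hf : GermC f q x) (hg : GermC g q x) :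
    der (f - g) q x = der f q x - der g q x := by
  simp only [der, ext_sub]
  exact iteratedDeriv_sub hf hg

theorem V.germC (f : V a) {q : ℕ} {x : I} (hx : ∀ j < q, a j ≠ x) : GermC f.fn q x :=
  f.mem.germC hx

theorem continuousAt_der (f : V a) {q : ℕ} {x : I} (hx : ∀ j < q, a j ≠ x) :
    ContinuousAt (der f.fn q) x :=
  continuousAt_iteratedDeriv (f.germC hx)

theorem dense_compl_points (a : ℕ → I) : Dense {y : ℝ | ∀ i, (a i : ℝ) ≠ y} := by
  convert (countable_range fun i => (a i : ℝ)).dense_compl ℝ using 1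
  ext y
  simp

/-- Near a point that is not among the first `q` terms of the sequence, no point is. -/
theorem eventually_avoid_nhds (a : ℕ → I) {q : ℕ} {x : I} (hx : ∀ j < q, a j ≠ x) :
    ∀ᶠ y in 𝓝 (x : ℝ), ∃ z : I, (z : ℝ) = y ∧ ∀ j < q, a j ≠ z := by
  have h := eventually_avoid a q x
  rw [eventually_nhdsWithin_iff] at h
  filter_upwards [h] with y hy
  by_cases hxy : y = x
  · exact ⟨x, hxy.symm, hx⟩
  · exact hy hxy

theorem eventually_avoid_left (a : ℕ → I) (q : ℕ) (x : I) :
    ∀ᶠ y in 𝓝[<] (x : ℝ), ∃ z : I, (z : ℝ) = y ∧ ∀ j < q, a j ≠ z :=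
  (eventually_avoid a q x).filter_mono (nhdsWithin_mono _ fun _ hy => ne_of_lt hy)

theorem eventually_avoid_right (a : ℕ → I) (q : ℕ) (x : I) :
    ∀ᶠ y in 𝓝[>] (x : ℝ), ∃ z : I, (z : ℝ) = y ∧ ∀ j < q, a j ≠ z :=
  (eventually_avoid a q x).filter_mono (nhdsWithin_mono _ fun _ hy => ne_of_gt hy)

theorem exists_mem_of_nhds {K : Set I} {x : I} (hK : K ∈ 𝓝 x) :
    ∀ᶠ y in 𝓝 (x : ℝ), ∃ z : I, (z : ℝ) = y ∧ K ∈ 𝓝 z := by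
  have h := (isOpen_Ioo.isOpenEmbedding_subtypeVal (X := ℝ) (s := Ioo (-1 : ℝ) 1)).map_nhds_eq x
  have h2 : ∀ᶠ z in 𝓝 x, K ∈ 𝓝 z := eventually_mem_nhds_iff.2 hK
  rw [← h, eventually_map]
  exact h2.mono fun z hz => ⟨z, rfl, hz⟩

theorem V.tendsto_derLeft (f : V a) (q : ℕ) (i : ℕ) :
    Tendsto (der f.fn q) (𝓝[<] (a i : ℝ)) (𝓝 (derLeft f.fn q (a i))) :=
  tendsto_nhds_limUnder (f.mem.limLeft (a i) (mem_range_self i) q)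

theorem V.tendsto_derRight (f : V a) (q : ℕ) (i : ℕ) :
    Tendsto (der f.fn q) (𝓝[>] (a i : ℝ)) (𝓝 (derRight f.fn q (a i))) :=
  tendsto_nhds_limUnder (f.mem.limRight (a i) (mem_range_self i) q)

theorem derLeft_eq {f : I → ℝ} {q : ℕ} {x l : ℝ} (h : Tendsto (der f q) (𝓝[<] x) (𝓝 l)) :
    derLeft f q x = l := h.limUnder_eq

theorem derRight_eq {f : I → ℝ} {q : ℕ} {x l : ℝ} (h : Tendsto (der f q) (𝓝[>] x) (𝓝 l)) :
    derRight f q x = l := h.limUnder_eq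

theorem derLeft_add (f g : V a) (q i : ℕ) :
    derLeft (f + g).fn q (a i) = derLeft f.fn q (a i) + derLeft g.fn q (a i) :=
  derLeft_eq (((f.tendsto_derLeft q i).add (g.tendsto_derLeft q i)).congr'
    ((der_add_eventually f.mem g.mem q (a i)).filter_mono
      (nhdsWithin_mono _ fun _ hy => ne_of_lt hy)))

theorem derRight_add (f g : V a) (q i : ℕ) :
    derRight (f + g).fn q (a i) = derRight f.fn q (a i) + derRight g.fn q (a i) :=
  derRight_eq (((f.tendsto_derRight q i).add (g.tendsto_derRight q i)).congr'
    ((der_add_eventually f.mem g.mem q (a i)).filter_mono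
      (nhdsWithin_mono _ fun _ hy => ne_of_gt hy)))

theorem derLeft_smul (c : ℝ) (f : V a) (q i : ℕ) :
    derLeft (c • f).fn q (a i) = c * derLeft f.fn q (a i) :=
  derLeft_eq (((f.tendsto_derLeft q i).const_mul c).congr fun y => (der_smul c f.fn q y).symm)

theorem derRight_smul (c : ℝ) (f : V a) (q i : ℕ) :
    derRight (c • f).fn q (a i) = c * derRight f.fn q (a i) :=
  derRight_eq (((f.tendsto_derRight q i).const_mul c).congr fun y => (der_smul c f.fn q y).symm)

theorem derLeft_sub (f g : V a) (q i : ℕ) :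
    derLeft (f - g).fn q (a i) = derLeft f.fn q (a i) - derLeft g.fn q (a i) := by
  rw [eq_sub_iff_add_eq, ← derLeft_add, sub_add_cancel]

theorem derRight_sub (f g : V a) (q i : ℕ) :
    derRight (f - g).fn q (a i) = derRight f.fn q (a i) - derRight g.fn q (a i) := by
  rw [eq_sub_iff_add_eq, ← derRight_add, sub_add_cancel]

theorem derLeft_of_germC {f : I → ℝ} {q : ℕ} {x : I} (h : GermC f q x) :
    derLeft f q x = der f q x :=
  derLeft_eq ((continuousAt_iteratedDeriv h).mono_left nhdsWithin_le_nhds)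

theorem derRight_of_germC {f : I → ℝ} {q : ℕ} {x : I} (h : GermC f q x) :
    derRight f q x = der f q x :=
  derRight_eq ((continuousAt_iteratedDeriv h).mono_left nhdsWithin_le_nhds)

/-! ### Seminorm bounds -/

theorem seminormV_le {K : TopologicalSpace.Compacts I} {p : ℕ} {f : V a} {M : ℝ} (hM : 0 ≤ M)
    (h : ∀ x ∈ K, x ∉ range a → ∀ q ≤ p, |der f.fn q x| ≤ M) : seminormV a K p f ≤ M := by
  refine Real.sSup_le ?_ hM
  rintro y ⟨x, hxK, hxa, q, hq, rfl⟩
  exact h x hxK hxa q hq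

theorem le_seminormV_of_notMem {K : TopologicalSpace.Compacts I} {p q : ℕ} (f : V a) {x : I}
    (hxK : x ∈ K) (hxa : x ∉ range a) (hq : q ≤ p) : |der f.fn q x| ≤ seminormV a K p f :=
  le_csSup (absValues_bddAbove K p f) ⟨x, hxK, hxa, q, hq, rfl⟩

theorem seminormV_mono {K L : TopologicalSpace.Compacts I} {p r : ℕ} (hK : (K : Set I) ⊆ L)
    (hp : p ≤ r) (f : V a) : seminormV a K p f ≤ seminormV a L r f :=
  seminormV_le (apply_nonneg _ _) fun _ hx hxa _ hq =>
    le_seminormV_of_notMem f (hK hx) hxa (hq.trans hp)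

/-- The supremum only sees `K \ S`. Since `S` is countable its complement is dense, so continuity
carries the bound to those points of `S` where the derivative exists. -/
theorem le_seminormV {K : TopologicalSpace.Compacts I} {p q : ℕ} (f : V a) {x : I}
    (hK : (K : Set I) ∈ 𝓝 x) (hx : ∀ j < q, a j ≠ x) (hq : q ≤ p) :
    |der f.fn q x| ≤ seminormV a K p f := by
  by_contra! hlt
  have h1 := (continuousAt_der f hx).abs.eventually (lt_mem_nhds hlt)
  obtain ⟨y, hy2, hy1, z, rfl, hzK⟩ :=
    (dense_compl_points a).inter_nhds_nonempty (h1.and (exists_mem_of_nhds hK))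
  refine hy1.not_ge (le_seminormV_of_notMem f (mem_of_mem_nhds hzK) ?_ hq)
  rintro ⟨j, rfl⟩
  exact hy2 j rfl

theorem abs_derLeft_le_seminormV {K : TopologicalSpace.Compacts I} {p q : ℕ} (f : V a) {i : ℕ}
    (hK : (K : Set I) ∈ 𝓝 (a i)) (hq : q ≤ p) :
    |derLeft f.fn q (a i)| ≤ seminormV a K p f := by
  refine le_of_tendsto (f.tendsto_derLeft q i).abs ?_
  filter_upwards [eventually_avoid_left a q (a i),
    nhdsWithin_le_nhds (exists_mem_of_nhds hK)] with y ⟨z, hz, hj⟩ ⟨w, hw, hwK⟩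
  obtain rfl : z = w := Subtype.ext (hz.trans hw.symm)
  exact hz ▸ le_seminormV f hwK hj hq

theorem abs_derRight_le_seminormV {K : TopologicalSpace.Compacts I} {p q : ℕ} (f : V a) {i : ℕ}
    (hK : (K : Set I) ∈ 𝓝 (a i)) (hq : q ≤ p) :
    |derRight f.fn q (a i)| ≤ seminormV a K p f := by
  refine le_of_tendsto (f.tendsto_derRight q i).abs ?_
  filter_upwards [eventually_avoid_right a q (a i),
    nhdsWithin_le_nhds (exists_mem_of_nhds hK)] with y ⟨z, hz, hj⟩ ⟨w, hw, hwK⟩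
  obtain rfl : z = w := Subtype.ext (hz.trans hw.symm)
  exact hz ▸ le_seminormV f hwK hj hq

/-! ### The topology is generated by countably many seminorms -/

instance : LocallyCompactSpace I := isOpen_Ioo.locallyCompactSpace

/-- An exhaustion of `(-1, 1)` by compact sets. -/
def exhaustion : CompactExhaustion I := default

def exhaustionCompacts (m : ℕ) : TopologicalSpace.Compacts I :=
  ⟨exhaustion m, exhaustion.isCompact m⟩

/-- A countable increasing family of seminorms that generates the topology of `𝓥`. -/
def seminormsN (a : ℕ → I) : SeminormFamily ℝ (V a) ℕ :=
  fun m => seminormV a (exhaustionCompacts m) m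

theorem exists_seminormV_le (K : TopologicalSpace.Compacts I) (p : ℕ) :
    ∃ m, ∀ f : V a, seminormV a K p f ≤ seminormsN a m f := by
  obtain ⟨m, hm⟩ := exhaustion.exists_superset_of_isCompact K.isCompact
  exact ⟨max m p, fun f => seminormV_mono (hm.trans (exhaustion.subset (le_max_left _ _)))
    (le_max_right _ _) f⟩

theorem seminormsN_mono : Monotone (seminormsN a) := fun _ _ h f =>
  seminormV_mono (exhaustion.subset h) h f

theorem withSeminormsN (a : ℕ → I) : WithSeminorms (seminormsN a) := by
  refine (withSeminormsV a).congr (fun m => ?_) (fun i => ?_)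
  · refine ⟨{(exhaustionCompacts m, m)}, 1, fun f => ?_⟩
    simp [seminormsN, seminormsV]
  · obtain ⟨m, hm⟩ := exists_seminormV_le (a := a) i.1 i.2
    refine ⟨{m}, 1, fun f => ?_⟩
    simpa [seminormsV] using hm f

instance : FirstCountableTopology (V a) := (withSeminormsN a).firstCountableTopology

instance : (uniformity (V a)).IsCountablyGenerated :=
  IsUniformAddGroup.uniformity_countably_generated

instance : T1Space (V a) := by
  refine (withSeminormsV a).T1_of_separating fun f hf => ?_
  contrapose! hf
  refine V.ext fun x => ?_
  obtain ⟨m, hm⟩ := exhaustion.exists_mem_nhds x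
  have h := le_seminormV (K := exhaustionCompacts m) f hm (q := 0) (p := 0) (by simp) le_rfl
  have h2 : seminormV a (exhaustionCompacts m) 0 f = 0 := hf (exhaustionCompacts m, 0)
  rw [h2, der_zero_apply] at h
  rw [V.fn_zero]
  simpa using h

theorem metrizableSpace_V (a : ℕ → I) : TopologicalSpace.MetrizableSpace (V a) :=
  UniformSpace.metrizableSpace

theorem locallyConvexSpace_V (a : ℕ → I) : LocallyConvexSpace ℝ (V a) :=
  (withSeminormsV a).toLocallyConvexSpace

/-- Nearness in `𝓥` can be tested with one of the seminorms. -/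
theorem mem_nhds_V_iff {f : V a} {U : Set (V a)} :
    U ∈ 𝓝 f ↔ ∃ m : ℕ, ∃ ε > 0, ∀ g, seminormsN a m (g - f) < ε → g ∈ U := by
  rw [(withSeminormsN a).mem_nhds_iff]
  constructor
  · rintro ⟨s, r, hr, h⟩
    refine ⟨s.sup id, r, hr, fun g hg => h ?_⟩
    rw [Seminorm.mem_ball]
    refine Seminorm.finset_sup_apply_lt hr fun i hi => (seminormsN_mono ?_ _).trans_lt hg
    exact Finset.le_sup (f := id) hi
  · rintro ⟨m, ε, hε, h⟩
    refine ⟨{m}, ε, hε, fun g hg => h g ?_⟩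
    simpa [Seminorm.mem_ball] using hg

/-! ### Completeness. -/

/-- The points of `(-1, 1)` that are not among the first `q` terms of the sequence. -/
def avoidSet (a : ℕ → I) (q : ℕ) : Set ℝ := {y | ∃ z : I, (z : ℝ) = y ∧ ∀ j < q, a j ≠ z}

theorem mem_avoidSet {q : ℕ} {x : I} : (x : ℝ) ∈ avoidSet a q ↔ ∀ j < q, a j ≠ x := by
  constructor
  · rintro ⟨z, hz, h⟩
    rwa [Subtype.ext hz] at h
  · exact fun h => ⟨x, rfl, h⟩

theorem isOpen_avoidSet (a : ℕ → I) (q : ℕ) : IsOpen (avoidSet a q) := by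
  rw [isOpen_iff_mem_nhds]
  rintro _ ⟨z, rfl, hz⟩
  exact eventually_avoid_nhds a hz

theorem avoidSet_anti {q r : ℕ} (h : q ≤ r) : avoidSet a r ⊆ avoidSet a q :=
  fun _ ⟨z, hz, hj⟩ => ⟨z, hz, fun j hj' => hj j (by omega)⟩

theorem ext_eventuallyEq {D : ℝ → ℝ} (x : I) :
    ext (fun y : I => D y) =ᶠ[𝓝 (x : ℝ)] D := by
  filter_upwards [Ioo_mem_nhds x.2.1 x.2.2] with y hy
  exact ext_coe (fun y : I => D y) ⟨y, hy⟩

theorem cauchySeq_seminormV {u : ℕ → V a} (hu : CauchySeq u) (K : TopologicalSpace.Compacts I)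
    (p : ℕ) {ε : ℝ} (hε : 0 < ε) : ∃ N, ∀ j ≥ N, ∀ l ≥ N, seminormV a K p (u j - u l) < ε := by
  have h := cauchySeq_iff_tendsto.1 hu
  rw [uniformity_eq_comap_nhds_zero, tendsto_comap_iff] at h
  have h2 := ((withSeminormsV a).continuous_seminorm (K, p)).tendsto 0 |>.comp h
  rw [map_zero] at h2
  obtain ⟨⟨N, M⟩, hN⟩ := eventually_atTop.1 (h2.eventually (gt_mem_nhds hε))
  refine ⟨max N M, fun j hj l hl => ?_⟩
  exact hN (l, j) ⟨(le_max_left _ _).trans hl, (le_max_right _ _).trans hj⟩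

/-- One neighbourhood `s` serves every order `q`; only the finitely many points removed from it
depend on `q`. -/
theorem uniformCauchySeqOn_der {u : ℕ → V a} (hu : CauchySeq u) (x : I) :
    ∃ s : Set ℝ, IsOpen s ∧ (x : ℝ) ∈ s ∧
      ∀ q, UniformCauchySeqOn (fun j => der (u j).fn q) atTop (s ∩ avoidSet a q) := by
  obtain ⟨m, hm⟩ := exhaustion.exists_mem_nhds x
  obtain ⟨s, hs, hso, hxs⟩ := eventually_nhds_iff.1 (exists_mem_of_nhds hm)
  refine ⟨s, hso, hxs, fun q => Metric.uniformCauchySeqOn_iff.2 fun ε hε => ?_⟩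
  obtain ⟨N, hN⟩ := cauchySeq_seminormV hu (exhaustionCompacts m) q hε
  refine ⟨N, fun j hj l hl y hy => ?_⟩
  obtain ⟨hys, z, rfl, hz⟩ := hy
  obtain ⟨w, hw, hwK⟩ := hs _ hys
  obtain rfl : z = w := Subtype.ext hw.symm
  rw [Real.dist_eq, ← der_sub ((u j).germC hz) ((u l).germC hz), ← V.fn_sub]
  exact (le_seminormV _ hwK hz le_rfl).trans_lt (hN j hj l hl)

/-- The pointwise limits of the derivatives along a sequence. -/
def limDer (u : ℕ → V a) (q : ℕ) (y : ℝ) : ℝ := limUnder atTop fun j => der (u j).fn q y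

theorem tendstoUniformlyOn_limDer {u : ℕ → V a} (hu : CauchySeq u) (x : I) :
    ∃ s : Set ℝ, IsOpen s ∧ (x : ℝ) ∈ s ∧
      ∀ q, TendstoUniformlyOn (fun j => der (u j).fn q) (limDer u q) atTop (s ∩ avoidSet a q) := by
  obtain ⟨s, hs, hxs, h⟩ := uniformCauchySeqOn_der hu x
  exact ⟨s, hs, hxs, fun q => (h q).tendstoUniformlyOn_of_tendsto fun y hy =>
    ((h q).cauchySeq hy).tendsto_limUnder⟩

theorem contDiffAt_limDer {u : ℕ → V a} (hu : CauchySeq u) {q : ℕ} {x : I}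
    (hx : ∀ j < q, a j ≠ x) :
    GermC (fun y : I => limDer u 0 y) q x ∧
      der (fun y : I => limDer u 0 y) q x = limDer u q x := by
  obtain ⟨s, hs, hxs, h⟩ := tendstoUniformlyOn_limDer hu x
  have ho : IsOpen (s ∩ avoidSet a q) := hs.inter (isOpen_avoidSet a q)
  have hxm : (x : ℝ) ∈ s ∩ avoidSet a q := ⟨hxs, mem_avoidSet.2 hx⟩
  obtain ⟨h1, h2⟩ := contDiffOn_of_tendstoUniformlyOn (P := q) (F := fun j => ext (u j).fn)
    (D := limDer u) ho
    (fun j y ⟨_, z, hz, hy⟩ => hz ▸ ((u j).germC hy : ContDiffAt ℝ q _ _).contDiffWithinAt)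
    (fun r hr => (h r).mono (inter_subset_inter_right _ (avoidSet_anti hr)))
  refine ⟨(h1.contDiffAt (ho.mem_nhds hxm)).congr_of_eventuallyEq (ext_eventuallyEq x), ?_⟩
  rw [der, (ext_eventuallyEq x).iteratedDeriv_eq, h2 q le_rfl x hxm]

/-- Interchange of limits: by uniformity the one-sided limits `L j` form a Cauchy sequence, and its
limit is the one-sided limit of the limit function. -/
theorem exists_tendsto_of_uniform {u : ℕ → V a} (hu : CauchySeq u) {q i : ℕ} {l : Filter ℝ}
    [l.NeBot] (hl : l ≤ 𝓝[≠] (a i : ℝ)) {L : ℕ → ℝ}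
    (hL : ∀ j, Tendsto (der (u j).fn q) l (𝓝 (L j))) :
    ∃ m, Tendsto (der (fun y : I => limDer u 0 y) q) l (𝓝 m) := by
  obtain ⟨s, hs, hxs, h⟩ := tendstoUniformlyOn_limDer hu (a i)
  have hmem : s ∩ avoidSet a q ∈ l := inter_mem (hl (nhdsWithin_le_nhds (hs.mem_nhds hxs)))
    (hl (eventually_avoid a q (a i)))
  have hc : CauchySeq L := by
    rw [Metric.cauchySeq_iff]
    intro ε hε
    obtain ⟨N, hN⟩ := Metric.uniformCauchySeqOn_iff.1 (h q).uniformCauchySeqOn (ε / 2) (by linarith)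
    refine ⟨N, fun j hj k hk => lt_of_le_of_lt ?_ (half_lt_self hε)⟩
    refine le_of_tendsto ((hL j).dist (hL k)) ?_
    filter_upwards [hmem] with y hy using (hN j hj k hk y hy).le
  obtain ⟨m, hm⟩ := cauchySeq_tendsto_of_complete hc
  refine ⟨m, Tendsto.congr' ?_ (TendstoUniformlyOnFilter.tendsto_of_eventually_tendsto
    ((h q).tendstoUniformlyOnFilter.mono_right (le_principal_iff.2 hmem))
    (Eventually.of_forall hL) hm)⟩
  filter_upwards [hmem] with y ⟨_, z, hz, hy⟩
  rw [← hz, (contDiffAt_limDer hu hy).2]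

theorem memV_limDer (ha : Function.Injective a) {u : ℕ → V a} (hu : CauchySeq u) :
    MemV a fun y : I => limDer u 0 y := by
  refine ⟨?_, fun x hx p => ?_, fun p => ?_, ?_, ?_⟩
  · rw [continuous_iff_continuousAt]
    intro x
    have h := (contDiffAt_limDer hu (q := 0) (x := x) (by simp)).1
    have h2 := ContDiffAt.continuousAt h
    have h3 : (fun y : I => limDer u 0 y) = ext (fun y : I => limDer u 0 y) ∘ Subtype.val :=
      funext fun y => (ext_coe (fun y : I => limDer u 0 y) y).symm
    rw [h3]
    exact h2.comp continuous_subtype_val.continuousAt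
  · exact (contDiffAt_limDer hu fun j _ h => hx ⟨j, h⟩).1
  · exact (contDiffAt_limDer hu fun j hj h => hj.ne (ha h)).1
  · rintro _ ⟨i, rfl⟩ p
    exact exists_tendsto_of_uniform hu (nhdsWithin_mono _ fun _ hy => ne_of_lt hy)
      fun j => (u j).tendsto_derLeft p i
  · rintro _ ⟨i, rfl⟩ p
    exact exists_tendsto_of_uniform hu (nhdsWithin_mono _ fun _ hy => ne_of_gt hy)
      fun j => (u j).tendsto_derRight p i

theorem completeSpace_V (ha : Function.Injective a) : CompleteSpace (V a) := by
  refine UniformSpace.complete_of_cauchySeq_tendsto fun u hu => ⟨(memV_limDer ha hu).toV, ?_⟩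
  rw [(withSeminormsV a).tendsto_nhds_atTop]
  rintro ⟨K, p⟩ ε hε
  obtain ⟨N, hN⟩ := cauchySeq_seminormV hu K p (half_pos hε)
  refine ⟨N, fun j hj => lt_of_le_of_lt (seminormV_le (half_pos hε).le ?_) (half_lt_self hε)⟩
  intro x hxK hxa q hq
  have hx : ∀ j < q, a j ≠ x := fun j _ h => hxa ⟨j, h⟩
  rw [V.fn_sub, der_sub ((u j).germC hx) (V.germC _ hx), MemV.toV_fn, (contDiffAt_limDer hu hx).2]
  obtain ⟨s, -, hxs, h⟩ := tendstoUniformlyOn_limDer hu x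
  have ht := (h q).tendsto_at ⟨hxs, mem_avoidSet.2 hx⟩
  refine le_of_tendsto (tendsto_const_nhds.sub ht).abs ?_
  filter_upwards [eventually_ge_atTop N] with l hl
  rw [← der_sub ((u j).germC hx) ((u l).germC hx), ← V.fn_sub]
  exact (le_seminormV_of_notMem _ hxK hxa hq).trans (hN j hj l hl).le

/-! ### Jets and the open conditions imposed on them. -/

/-- Pairwise distinct points that are not among `a_0, …, a_p`. -/
def admissible (a : ℕ → I) (n p : ℕ) : Set (Fin n → I) :=
  {x | Function.Injective x ∧ ∀ i, ∀ j < p + 1, a j ≠ x i}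

/-- Avoiding all of `S` would not be an open condition. Avoiding `a 0, …, a p` is one, and it
suffices for derivatives up to order `p` to exist. -/
theorem isOpen_admissible (a : ℕ → I) (n p : ℕ) : IsOpen (admissible a n p) := by
  have h : admissible a n p = (⋂ i : Fin n, ⋂ j : Fin n, ⋂ _ : i ≠ j, {x | x i ≠ x j}) ∩
      ⋂ i : Fin n, ⋂ j : Fin (p + 1), {x | a j ≠ x i} := by
    ext x
    simp only [admissible, mem_ofPred_eq, mem_inter_iff, mem_iInter]
    refine and_congr ?_ ?_
    · exact ⟨fun h i j hij he => hij (h he), fun h i j he => by_contra fun hij => h i j hij he⟩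
    · exact ⟨fun h i j => h i j j.2, fun h i j hj => h i ⟨j, hj⟩⟩
  rw [h]
  refine IsOpen.inter ?_ ?_
  · refine isOpen_iInter_of_finite fun i => isOpen_iInter_of_finite fun j =>
      isOpen_iInter_of_finite fun _ => isOpen_ne_fun (continuous_apply i) (continuous_apply j)
  · refine isOpen_iInter_of_finite fun i => isOpen_iInter_of_finite fun j =>
      isOpen_ne_fun continuous_const (continuous_apply i)

instance (n p : ℕ) : LocallyCompactSpace (admissible a n p) :=
  (isOpen_admissible a n p).locallyCompactSpace

/-- The index set of the entries of a jet together with its base points. -/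
abbrev JetIndex (n p k : ℕ) : Type :=
  Fin n ⊕ (Fin n × Fin (p + 1)) ⊕ (Fin (k + 1) × Fin (p + 1)) ⊕ (Fin (k + 1) × Fin (p + 1))

/-- The points `x`, the derivatives of `f` at `x`, and the left and right limits of the derivatives
of `f` at `a_0, …, a_k`. -/
def jetFun (f : V a) {n : ℕ} (p k : ℕ) (x : Fin n → I) : JetIndex n p k → ℝ :=
  Sum.elim (fun i => x i) <| Sum.elim (fun i => der f.fn i.2 (x i.1)) <|
    Sum.elim (fun i => derLeft f.fn i.2 (a i.1)) (fun i => derRight f.fn i.2 (a i.1))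

/-- For `q ≤ i` both one-sided limits at `a i` equal the derivative itself, so `jetFun` merely
repeats that entry. -/
theorem range_jetFun_subset (ha : Function.Injective a) (f : V a) {n p k : ℕ} (x : Fin n → I) :
    range (jetFun f p k x) ⊆ fullJet f n p k x := by
  have hg : ∀ i : Fin (k + 1), ∀ q : Fin (p + 1), (q : ℕ) ≤ i → GermC f.fn q (a i) :=
    fun i q hq => f.germC fun j hj h => (hj.trans_le hq).ne (ha h)
  rintro _ ⟨i | i | ⟨i, q⟩ | ⟨i, q⟩, rfl⟩
  · exact Or.inl (Or.inl ⟨i, rfl⟩)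
  · exact Or.inr (Or.inl (Or.inl ⟨i.1, i.2, Nat.lt_succ_iff.1 i.2.2, rfl⟩))
  · rcases le_or_gt (q : ℕ) i with h | h
    · exact Or.inr (Or.inl (Or.inr ⟨i, Nat.lt_succ_iff.1 i.2, q, h, derLeft_of_germC (hg i q h)⟩))
    · exact Or.inr (Or.inr ⟨i, Nat.lt_succ_iff.1 i.2, q, h, Nat.lt_succ_iff.1 q.2, Or.inl rfl⟩)
  · rcases le_or_gt (q : ℕ) i with h | h
    · exact Or.inr (Or.inl (Or.inr ⟨i, Nat.lt_succ_iff.1 i.2, q, h, derRight_of_germC (hg i q h)⟩))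
    · exact Or.inr (Or.inr ⟨i, Nat.lt_succ_iff.1 i.2, q, h, Nat.lt_succ_iff.1 q.2, Or.inr rfl⟩)

theorem continuous_of_abs_le_seminormV {φ : V a → ℝ} (hφ : ∀ f g, φ (f - g) = φ f - φ g)
    {K : TopologicalSpace.Compacts I} {p : ℕ} (h : ∀ f, |φ f| ≤ seminormV a K p f) :
    Continuous φ := by
  rw [continuous_iff_continuousAt]
  intro f
  rw [ContinuousAt, Metric.tendsto_nhds]
  intro ε hε
  filter_upwards [((withSeminormsV a).tendsto_nhds id f).1 tendsto_id (K, p) ε hε] with g hg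
  rw [Real.dist_eq, ← hφ]
  exact (h _).trans_lt hg

theorem continuous_derLeft (q i : ℕ) : Continuous fun f : V a => derLeft f.fn q (a i) := by
  obtain ⟨m, hm⟩ := exhaustion.exists_mem_nhds (a i)
  exact continuous_of_abs_le_seminormV (fun f g => derLeft_sub f g q i)
    fun f => abs_derLeft_le_seminormV (K := exhaustionCompacts m) f hm le_rfl

theorem continuous_derRight (q i : ℕ) : Continuous fun f : V a => derRight f.fn q (a i) := by
  obtain ⟨m, hm⟩ := exhaustion.exists_mem_nhds (a i)
  exact continuous_of_abs_le_seminormV (fun f g => derRight_sub f g q i)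
    fun f => abs_derRight_le_seminormV (K := exhaustionCompacts m) f hm le_rfl

/-- Joint continuity in the function and the point is what lets compactness in `x` give openness in
`f`. -/
theorem continuousAt_der_uncurry (f : V a) {q : ℕ} {x : I} (hx : ∀ j < q, a j ≠ x) :
    ContinuousAt (fun w : V a × I => der w.1.fn q w.2) (f, x) := by
  obtain ⟨m, hm⟩ := exhaustion.exists_mem_nhds x
  rw [ContinuousAt, Metric.tendsto_nhds, nhds_prod_eq]
  intro ε hε
  have h1 := ((withSeminormsV a).tendsto_nhds id f).1 tendsto_id
    (exhaustionCompacts m, q) (ε / 2) (half_pos hε)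
  have h2 := (Metric.tendsto_nhds.1 ((continuousAt_der f hx).comp
    continuous_subtype_val.continuousAt) (ε / 2) (half_pos hε)).and
      ((continuous_subtype_val.continuousAt.eventually (eventually_avoid_nhds a hx)).and
        (eventually_mem_nhds_iff.2 hm))
  filter_upwards [h1.prod_mk h2] with ⟨g, y⟩ ⟨hg, hy, ⟨z, hz, hzj⟩, hyK⟩
  obtain rfl : z = y := Subtype.ext hz
  refine (dist_triangle _ (der f.fn q z) _).trans_lt ?_
  rw [← add_halves ε]
  refine add_lt_add ?_ hy
  dsimp only
  rw [Real.dist_eq, ← der_sub (g.germC hzj) (f.germC hzj), ← V.fn_sub]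
  exact (le_seminormV _ hyK hzj le_rfl).trans_lt hg

theorem continuous_jetFun (n p k : ℕ) :
    Continuous fun w : V a × admissible a n p => jetFun w.1 p k w.2.1 := by
  rw [continuous_pi_iff]
  rintro (i | ⟨i, q⟩ | ⟨i, q⟩ | ⟨i, q⟩)
  · exact continuous_subtype_val.comp ((continuous_apply i).comp
      (continuous_subtype_val.comp continuous_snd))
  · rw [continuous_iff_continuousAt]
    rintro ⟨f, x⟩
    have h : Continuous fun w : V a × admissible a n p => (w.1, w.2.1 i) :=
      continuous_fst.prodMk ((continuous_apply i).comp (continuous_subtype_val.comp continuous_snd))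
    exact ContinuousAt.comp (f := fun w : V a × admissible a n p => (w.1, w.2.1 i))
      (g := fun w : V a × I => der w.1.fn q w.2) (x := (f, x)) (continuousAt_der_uncurry f fun j hj => x.2.2 i j (hj.trans q.2)) h.continuousAt
  · exact (continuous_derLeft q i).comp continuous_fst
  · exact (continuous_derRight q i).comp continuous_fst

/-- The elements of `𝓥` whose jets at the points of a compact set satisfy one of the inequations
given by a family of polynomials, indexed by the ways to select entries of the jet. -/
def jetAvoiding (a : ℕ → I) (n p k m : ℕ) {κ : Type}
    (P : (κ → JetIndex n p k) → MvPolynomial κ ℚ) : Set (V a) :=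
  {f | ∀ x ∈ compactCovering (admissible a n p) m,
    ∃ s, P s = 0 ∨ MvPolynomial.aeval (jetFun f p k x.1 ∘ s) (P s) ≠ 0}

theorem isOpen_jetAvoiding (n p k m : ℕ) {κ : Type}
    (P : (κ → JetIndex n p k) → MvPolynomial κ ℚ) : IsOpen (jetAvoiding a n p k m P) := by
  have hW : IsOpen {w : V a × admissible a n p |
      ∃ s, P s = 0 ∨ MvPolynomial.aeval (jetFun w.1 p k w.2.1 ∘ s) (P s) ≠ 0} := by
    simp only [ofPred_exists]
    refine isOpen_iUnion fun s => ?_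
    simp only [ofPred_or]
    refine isOpen_const.union (isOpen_ne_fun ?_ continuous_const)
    simp only [MvPolynomial.aeval_def, ← MvPolynomial.eval_map]
    refine (MvPolynomial.continuous_eval _).comp (continuous_pi fun j => ?_)
    exact (continuous_apply (s j)).comp (continuous_jetFun n p k)
  rw [isOpen_iff_mem_nhds]
  intro f hf
  exact (isCompact_compactCovering (admissible a n p) m).eventually_forall_of_forall_eventually
    fun x hx => hW.mem_nhds (hf x hx)

/-- If `f` avoids all polynomial conditions, then its jets have many algebraically independent
entries. -/
theorem exists_algebraicIndependent_of_jetAvoiding {f : V a} {n p k : ℕ} {κ : Type}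
    (hf : ∀ m (P : (κ → JetIndex n p k) → MvPolynomial κ ℚ), f ∈ jetAvoiding a n p k m P)
    {x : Fin n → I} (hx : x ∈ admissible a n p) :
    ∃ s, AlgebraicIndependent ℚ (jetFun f p k x ∘ s : κ → ℝ) := by
  by_contra! h
  have h2 : ∀ s, ∃ P : MvPolynomial κ ℚ, MvPolynomial.aeval (jetFun f p k x ∘ s) P = 0 ∧ P ≠ 0 := by
    intro s
    have := h s
    rw [algebraicIndependent_iff] at this
    push Not at this
    exact this
  choose P hP hP0 using h2
  obtain ⟨m, hm⟩ := exists_mem_compactCovering (⟨x, hx⟩ : admissible a n p)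
  obtain ⟨s, hs⟩ := hf m P ⟨x, hx⟩ hm
  exact hs.elim (hP0 s) fun h => h (hP s)

/-! ### Algebraic independence and transcendence degree. -/

theorem countable_mvPolynomial (κ R : Type) [Countable κ] [CommSemiring R] [Countable R] :
    Countable (MvPolynomial κ R) := by
  rw [← Cardinal.mk_le_aleph0_iff]
  refine MvPolynomial.cardinalMk_le_max.trans ?_
  simp

/-- Tuples that are algebraically independent over a countable field are dense. -/
theorem dense_algebraicIndependent (K : Subfield ℝ) [Countable K] (κ : Type) [Finite κ] :
    Dense {c : κ → ℝ | AlgebraicIndependent K c} := by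
  have hc := countable_mvPolynomial κ K
  have h : {c : κ → ℝ | AlgebraicIndependent K c} =
      ⋂ P : {P : MvPolynomial κ K // P ≠ 0}, {c | MvPolynomial.aeval c P.1 ≠ 0} := by
    ext c
    simp only [mem_ofPred_eq, algebraicIndependent_iff, mem_iInter, Subtype.forall]
    exact forall_congr' fun P => ⟨fun h h1 h2 => h1 (h h2), fun h h2 => by_contra fun h1 => h h1 h2⟩
  have he : ∀ (P : MvPolynomial κ K) (c : κ → ℝ), MvPolynomial.aeval c P =
      MvPolynomial.eval c (MvPolynomial.map (algebraMap K ℝ) P) := fun P c => by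
    rw [MvPolynomial.aeval_def, MvPolynomial.eval_map]
  rw [h]
  -- Baire in `κ → ℝ`: a polynomial that vanishes on a product of infinite sets is zero, so each
  -- nonvanishing locus is dense.
  refine dense_iInter_of_isOpen (fun P => ?_) (fun P => ?_)
  · simp only [he]
    exact isOpen_ne_fun (MvPolynomial.continuous_eval _) continuous_const
  · rw [dense_iff_inter_open]
    rintro U hU ⟨c, hcU⟩
    by_contra hne
    obtain ⟨t, ht, htU⟩ := isOpen_pi_iff'.1 hU c hcU
    refine P.2 ?_
    have hinj := MvPolynomial.map_injective (σ := κ) (algebraMap K ℝ) (algebraMap K ℝ).injective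
    refine hinj ?_
    rw [map_zero]
    refine MvPolynomial.funext_set t (fun i => ?_) fun x hx => ?_
    · exact infinite_of_mem_nhds (c i) ((ht i).1.mem_nhds (ht i).2)
    · rw [map_zero, ← he]
      by_contra hx0
      exact hne ⟨x, htU hx, hx0⟩

/-- The field generated by a set lies in the closure of the set in the matroid of algebraic
independence. -/
theorem adjoin_subset_matroid_closure (K : Type) [Field K] [Algebra K ℝ] (T : Set ℝ) :
    (IntermediateField.adjoin K T : Set ℝ) ⊆ (AlgebraicIndependent.matroid K ℝ).closure T := by
  rw [AlgebraicIndependent.matroid_closure_eq]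
  intro w hw
  obtain ⟨x, hx, y, hy, hxy⟩ := IntermediateField.mem_adjoin_iff_div.1 hw
  rw [SetLike.mem_coe, hxy, div_eq_mul_inv]
  have hal : ∀ w ∈ Algebra.adjoin K T, IsAlgebraic (Algebra.adjoin K T) w := fun w hw =>
    isAlgebraic_algebraMap (⟨w, hw⟩ : Algebra.adjoin K T)
  exact (hal x hx).mul (hal y hy).inv

theorem encard_range_le_eRk {K κ : Type} [Field K] [Algebra K ℝ] {T : Set ℝ} {c : κ → ℝ}
    (hc : AlgebraicIndependent K c) (h : ∀ j, c j ∈ IntermediateField.adjoin K T) :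
    (range c).encard ≤ (AlgebraicIndependent.matroid K ℝ).eRk T := by
  have hind : (AlgebraicIndependent.matroid K ℝ).Indep (range c) := by
    rw [AlgebraicIndependent.matroid_indep_iff]
    exact hc.coe_range
  rw [← Matroid.eRk_closure_eq]
  refine hind.encard_le_eRk_of_subset ?_
  rintro _ ⟨j, rfl⟩
  exact adjoin_subset_matroid_closure K T (h j)

/-- If a field generated over `K` by a family `z` contains the algebraically independent family `c`,
then as many members of `z` are algebraically independent. -/
theorem exists_algebraicIndependent_comp (K : Subfield ℝ) {ι κ : Type} [Finite ι] [Finite κ]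
    {z : ι → ℝ} {c : κ → ℝ} (hc : AlgebraicIndependent K c)
    (h : ∀ j, c j ∈ IntermediateField.adjoin K (range z)) :
    ∃ s : κ → ι, AlgebraicIndependent ℚ (z ∘ s) := by
  -- A maximal independent subset `B` of `range z` has at least as many elements as `c`, so `c`
  -- injects into it; the indices of the chosen elements form `s`.
  obtain ⟨B, hB⟩ := (AlgebraicIndependent.matroid K ℝ).exists_isBasis' (range z)
  have hcard : (range c).encard ≤ B.encard := by
    rw [hB.encard_eq_eRk]
    exact encard_range_le_eRk hc h
  have hBi : AlgebraicIndependent K ((↑) : B → ℝ) :=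
    (AlgebraicIndependent.matroid_indep_iff).1 hB.indep
  have hfin : B.Finite := (finite_range z).subset hB.subset
  obtain ⟨e, he⟩ : ∃ e : range c → B, Function.Injective e := by
    have hne : Nonempty ℝ := ⟨0⟩
    obtain ⟨e, he, hinj⟩ := (finite_range c).exists_injOn_of_encard_le hcard
    exact ⟨fun y => ⟨e y, he y.2⟩, fun y y' hyy => Subtype.ext (hinj y.2 y'.2
      (congrArg Subtype.val hyy))⟩
  choose s hs using fun b : B => hB.subset b.2
  refine ⟨fun j => s (e ⟨c j, j, rfl⟩), ?_⟩
  have h2 : AlgebraicIndependent K fun j => ((e ⟨c j, j, rfl⟩ : B) : ℝ) :=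
    hBi.comp _ fun i j hij => hc.injective (congrArg Subtype.val (he hij))
  have h3 : z ∘ (fun j => s (e ⟨c j, j, rfl⟩)) = fun j => ((e ⟨c j, j, rfl⟩ : B) : ℝ) :=
    funext fun j => hs _
  rw [h3]
  exact h2.restrictScalars (algebraMap ℚ K).injective

theorem mk_le_trdegQ {κ : Type} {T : Set ℝ} {c : κ → ℝ} (hc : AlgebraicIndependent ℚ c)
    (h : ∀ j, c j ∈ T) : Cardinal.mk κ ≤ trdegQ T := by
  have h2 : AlgebraicIndependent ℚ
      fun j => (⟨c j, IntermediateField.subset_adjoin ℚ T (h j)⟩ : IntermediateField.adjoin ℚ T) :=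
    AlgebraicIndependent.of_comp (IntermediateField.adjoin ℚ T).val hc
  exact h2.cardinalMk_le_trdeg

/-- Every independent family in the generated field lies in the matroid closure of `T`, so its size
is at most the rank of `T`. This upper bound serves only the proof of non-smoothness. -/
theorem trdegQ_le_card {ι : Type} [Fintype ι] {T : Set ℝ} {z : ι → ℝ} (h : T ⊆ range z) :
    trdegQ T ≤ (Fintype.card ι : Cardinal) := by
  refine ciSup_le' fun s => ?_
  have hs : AlgebraicIndependent ℚ ((↑) : s.1 → IntermediateField.adjoin ℚ T) := s.2
  have h1 := hs.map' (f := (IntermediateField.adjoin ℚ T).val) Subtype.val_injective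
  have h2 := encard_range_le_eRk (T := T) h1 fun j => j.1.2
  have h3 := h2.trans (((AlgebraicIndependent.matroid ℚ ℝ).eRk_le_encard T).trans
    (encard_le_encard h))
  have h4 : (range z).encard ≤ Fintype.card ι := by
    rw [encard, ENat.card, Cardinal.toENat_le_natCast, ← Cardinal.mk_fintype]
    exact Cardinal.mk_range_le
  rw [← Cardinal.mk_range_eq _ h1.injective, ← Cardinal.toENat_le_natCast]
  exact h3.trans h4

/-! ### Hermite interpolation over subfields. -/

/-- Each node is a root of multiplicity at least `p + 1`; the product of these coprime powers
divides `Q` but has larger degree. -/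
theorem eq_zero_of_iterate_derivative_eq_zero {k ι : Type*} [Field k] [CharZero k] [Fintype ι]
    {u : ι → k} (hu : Function.Injective u) {p : ℕ} {Q : Polynomial k}
    (hQ : Q ∈ Polynomial.degreeLT k (Fintype.card ι * (p + 1)))
    (h : ∀ i, ∀ r ≤ p, (Polynomial.derivative^[r] Q).eval (u i) = 0) : Q = 0 := by
  classical
  by_contra h0
  have h1 : ∀ i, (Polynomial.X - Polynomial.C (u i)) ^ (p + 1) ∣ Q := fun i => by
    rw [← Polynomial.le_rootMultiplicity_iff h0]
    exact (Polynomial.lt_rootMultiplicity_iff_isRoot_iterate_derivative h0).2 (h i)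
  have h2 : ∏ i, (Polynomial.X - Polynomial.C (u i)) ^ (p + 1) ∣ Q :=
    Finset.prod_dvd_of_coprime (fun i _ j _ hij =>
      (Polynomial.pairwise_coprime_X_sub_C hu hij).pow) fun i _ => h1 i
  have h3 : (∏ i, (Polynomial.X - Polynomial.C (u i)) ^ (p + 1)).degree =
      ((Fintype.card ι * (p + 1) : ℕ) : WithBot ℕ) := by
    rw [Polynomial.degree_prod]
    simp [Polynomial.degree_pow, mul_add]
  rw [Polynomial.mem_degreeLT, ← h3] at hQ
  exact (Polynomial.degree_le_of_dvd h2 h0).not_gt hQ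

/-- Hermite interpolation: a polynomial is defined over any field that contains sufficiently many
points and values of derivatives at these points. -/
theorem exists_map_eq_of_iterate_derivative {k L ι : Type*} [Field k] [CharZero k] [Field L]
    [Fintype ι] (φ : k →+* L) {u : ι → k} (hu : Function.Injective u) {p : ℕ} {Q : Polynomial L}
    (hQ : Q ∈ Polynomial.degreeLT L (Fintype.card ι * (p + 1))) (y : ι × Fin (p + 1) → k)
    (h : ∀ i, ∀ r : Fin (p + 1), (Polynomial.derivative^[r] Q).eval (φ (u i)) = φ (y (i, r))) :
    ∃ R : Polynomial k, R.map φ = Q := by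
  have hL : CharZero L := charZero_of_injective_ringHom φ.injective
  set N := Fintype.card ι * (p + 1) with hN
  let T : Polynomial.degreeLT k N →ₗ[k] (ι × Fin (p + 1) → k) := LinearMap.pi fun i =>
    (Polynomial.leval (u i.1)) ∘ₗ (Polynomial.derivative ^ (i.2 : ℕ)) ∘ₗ Submodule.subtype _
  have hT : ∀ R i, T R i = (Polynomial.derivative^[(i.2 : ℕ)] R.1).eval (u i.1) := fun R i => by
    simp [T, Module.End.pow_apply]
  have hinj : Function.Injective T := by
    rw [← LinearMap.ker_eq_bot, LinearMap.ker_eq_bot']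
    intro R hR
    refine Subtype.ext (eq_zero_of_iterate_derivative_eq_zero hu R.2 fun i r hr => ?_)
    rw [← hT R (i, ⟨r, Nat.lt_succ_of_le hr⟩), hR, Pi.zero_apply]
  have hfd : FiniteDimensional k (Polynomial.degreeLT k N) :=
    (Polynomial.degreeLTEquiv k N).symm.finiteDimensional
  -- Interpolation over the small field `k` is solvable because it is injective between spaces of
  -- equal dimension. Uniqueness over `L` then identifies the solution with `Q`.
  have hsurj : Function.Surjective T := by
    refine (LinearMap.injective_iff_surjective_of_finrank_eq_finrank ?_).1 hinj
    rw [(Polynomial.degreeLTEquiv k N).finrank_eq]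
    simp [hN]
  obtain ⟨R, hR⟩ := hsurj y
  refine ⟨R.1, ?_⟩
  rw [← sub_eq_zero]
  refine eq_zero_of_iterate_derivative_eq_zero (φ.injective.comp hu) (p := p) ?_ fun i r hr => ?_
  · refine Submodule.sub_mem _ ?_ hQ
    have := R.2
    rw [Polynomial.mem_degreeLT] at this ⊢
    rwa [Polynomial.degree_map]
  · have h1 := congrFun hR (i, ⟨r, Nat.lt_succ_of_le hr⟩)
    rw [hT] at h1
    rw [Polynomial.iterate_derivative_sub, Polynomial.eval_sub, Polynomial.iterate_derivative_map,
      sub_eq_zero, Function.comp_apply, h i ⟨r, Nat.lt_succ_of_le hr⟩, Polynomial.eval_map,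
      Polynomial.eval₂_at_apply, h1]

theorem coeff_mem_of_iterate_derivative_mem (F : Subfield ℝ) {ι : Type*} [Fintype ι] {u : ι → ℝ}
    (hu : Function.Injective u) (huF : ∀ i, u i ∈ F) {p : ℕ} {Q : Polynomial ℝ}
    (hQ : Q ∈ Polynomial.degreeLT ℝ (Fintype.card ι * (p + 1)))
    (h : ∀ i, ∀ r ≤ p, (Polynomial.derivative^[r] Q).eval (u i) ∈ F) (j : ℕ) : Q.coeff j ∈ F := by
  obtain ⟨R, hR⟩ := exists_map_eq_of_iterate_derivative F.subtype (u := fun i => ⟨u i, huF i⟩)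
    (fun i j hij => hu (congrArg Subtype.val hij)) hQ
    (fun i => ⟨_, h i.1 i.2 (Nat.lt_succ_iff.1 i.2.2)⟩) fun i r => rfl
  rw [← hR, Polynomial.coeff_map]
  exact (R.coeff j).2

/-! ### Polynomials and truncated powers as elements of `V a`. -/

theorem iteratedDeriv_eval (Q : Polynomial ℝ) (q : ℕ) :
    iteratedDeriv q (fun y => Q.eval y) = fun y => (Polynomial.derivative^[q] Q).eval y := by
  induction q generalizing Q with
  | zero => simp
  | succ q ih =>
    rw [iteratedDeriv_succ', Function.iterate_succ_apply, ← ih]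
    congr 1
    funext y
    exact Q.deriv

/-- The function that is `0` up to `b` and a polynomial after `b`. -/
def truncated (b : ℝ) (W : Polynomial ℝ) (y : ℝ) : ℝ := if b < y then W.eval y else 0

theorem truncated_eventuallyEq_right (W : Polynomial ℝ) {b y : ℝ} (h : b < y) :
    truncated b W =ᶠ[𝓝 y] fun z => W.eval z := by
  filter_upwards [lt_mem_nhds h] with z hz using if_pos hz

theorem truncated_eventuallyEq_left (W : Polynomial ℝ) {b y : ℝ} (h : y < b) :
    truncated b W =ᶠ[𝓝 y] fun _ => 0 := by
  filter_upwards [gt_mem_nhds h] with z hz using if_neg hz.not_gt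

theorem contDiff_eval (Q : Polynomial ℝ) (n : WithTop ℕ∞) : ContDiff ℝ n fun y => Q.eval y := by
  simpa using Q.contDiff_aeval (𝕜 := ℝ) n

theorem contDiffAt_truncated_of_ne (W : Polynomial ℝ) {b y : ℝ} (h : y ≠ b) (n : WithTop ℕ∞) :
    ContDiffAt ℝ n (truncated b W) y := by
  rcases lt_or_gt_of_ne h with h | h
  · exact contDiffAt_const.congr_of_eventuallyEq (truncated_eventuallyEq_left W h)
  · exact (contDiff_eval W n).contDiffAt.congr_of_eventuallyEq (truncated_eventuallyEq_right W h)

theorem iteratedDeriv_truncated_of_ne (W : Polynomial ℝ) {b y : ℝ} (h : y ≠ b) (r : ℕ) :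
    iteratedDeriv r (truncated b W) y = truncated b (Polynomial.derivative^[r] W) y := by
  rcases lt_or_gt_of_ne h with h | h
  · rw [(truncated_eventuallyEq_left W h).iteratedDeriv_eq, truncated, if_neg h.not_gt]
    simp [iteratedDeriv_fun_const_zero]
  · rw [(truncated_eventuallyEq_right W h).iteratedDeriv_eq, truncated, if_pos h,
      iteratedDeriv_eval]

theorem tendsto_iteratedDeriv_truncated_left (W : Polynomial ℝ) (b : ℝ) (r : ℕ) :
    Tendsto (iteratedDeriv r (truncated b W)) (𝓝[<] b) (𝓝 0) := by
  refine tendsto_const_nhds.congr' ?_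
  filter_upwards [self_mem_nhdsWithin] with y hy
  rw [iteratedDeriv_truncated_of_ne W (ne_of_lt hy), truncated, if_neg (not_lt_of_gt hy)]

theorem tendsto_iteratedDeriv_truncated_right (W : Polynomial ℝ) (b : ℝ) (r : ℕ) :
    Tendsto (iteratedDeriv r (truncated b W)) (𝓝[>] b)
      (𝓝 ((Polynomial.derivative^[r] W).eval b)) := by
  refine (((Polynomial.derivative^[r] W).continuous.tendsto b).mono_left
    nhdsWithin_le_nhds).congr' ?_
  filter_upwards [self_mem_nhdsWithin] with y hy
  rw [iteratedDeriv_truncated_of_ne W (ne_of_gt hy), truncated, if_pos (mem_Ioi.1 hy)]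

theorem contDiffAt_truncated {W : Polynomial ℝ} {b : ℝ} {n : ℕ}
    (hW : ∀ r ≤ n, (Polynomial.derivative^[r] W).eval b = 0) :
    ContDiffAt ℝ n (truncated b W) b := by
  have hb : truncated b W b = 0 := if_neg (lt_irrefl b)
  have hl : ∀ q ≤ n, Tendsto (iteratedDeriv q (truncated b W)) (𝓝[≠] b) (𝓝 0) := fun q hq => by
    rw [← nhdsLT_sup_nhdsGT]
    refine (tendsto_iteratedDeriv_truncated_left W b q).sup ?_
    have := tendsto_iteratedDeriv_truncated_right W b q
    rwa [hW q hq] at this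
  refine contDiffAt_of_punctured ?_ ?_ fun q hq => ⟨0, hl q hq⟩
  · rw [continuousAt_iff_punctured_nhds, hb]
    simpa using hl 0 (Nat.zero_le n)
  · filter_upwards [self_mem_nhdsWithin] with y hy using contDiffAt_truncated_of_ne W hy n

theorem tendsto_der_of_germC {f : I → ℝ} {q : ℕ} {x : I} (h : GermC f q x) {l : Filter ℝ}
    (hl : l ≤ 𝓝 (x : ℝ)) : Tendsto (der f q) l (𝓝 (der f q x)) :=
  (continuousAt_iteratedDeriv h).mono_left hl

theorem der_comp_val (D : ℝ → ℝ) (q : ℕ) (x : I) :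
    der (fun y : I => D y) q x = iteratedDeriv q D x :=
  (ext_eventuallyEq x).iteratedDeriv_eq q

theorem germC_comp_val {D : ℝ → ℝ} {q : ℕ} {x : I} (h : ContDiffAt ℝ q D x) :
    GermC (fun y : I => D y) q x :=
  ContDiffAt.congr_of_eventuallyEq h (ext_eventuallyEq x)

theorem der_comp_val_eventuallyEq (D : ℝ → ℝ) (q : ℕ) (x : I) :
    der (fun y : I => D y) q =ᶠ[𝓝 (x : ℝ)] iteratedDeriv q D := by
  filter_upwards [Ioo_mem_nhds x.2.1 x.2.2] with y hy using der_comp_val D q ⟨y, hy⟩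

theorem memV_poly (a : ℕ → I) (Q : Polynomial ℝ) : MemV a fun x : I => Q.eval (x : ℝ) := by
  have h : ∀ (p : ℕ) x, GermC (fun x : I => Q.eval (x : ℝ)) p x := fun p x =>
    germC_comp_val (D := fun y => Q.eval y) (contDiff_eval Q p).contDiffAt
  exact ⟨Q.continuous.comp continuous_subtype_val, fun x _ p => h p x, fun p => h p _,
    fun x _ p => ⟨_, tendsto_der_of_germC (h p x) nhdsWithin_le_nhds⟩,
    fun x _ p => ⟨_, tendsto_der_of_germC (h p x) nhdsWithin_le_nhds⟩⟩

/-- A polynomial, as an element of `𝓥`. -/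
def polyV (a : ℕ → I) (Q : Polynomial ℝ) : V a := (memV_poly a Q).toV

theorem der_polyV (Q : Polynomial ℝ) (q : ℕ) (x : I) :
    der (polyV a Q).fn q x = (Polynomial.derivative^[q] Q).eval (x : ℝ) :=
  (der_comp_val (fun y => Q.eval y) q x).trans (congrFun (iteratedDeriv_eval Q q) x)

theorem germC_polyV (Q : Polynomial ℝ) (q : ℕ) (x : I) : GermC (polyV a Q).fn q x :=
  germC_comp_val (D := fun y => Q.eval y) (contDiff_eval Q q).contDiffAt

theorem derLeft_polyV (Q : Polynomial ℝ) (q : ℕ) (x : I) :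
    derLeft (polyV a Q).fn q x = (Polynomial.derivative^[q] Q).eval (x : ℝ) := by
  rw [derLeft_of_germC (germC_polyV Q q x), der_polyV]

theorem derRight_polyV (Q : Polynomial ℝ) (q : ℕ) (x : I) :
    derRight (polyV a Q).fn q x = (Polynomial.derivative^[q] Q).eval (x : ℝ) := by
  rw [derRight_of_germC (germC_polyV Q q x), der_polyV]

/-- The polynomial `(X - b) ^ q`. -/
def shiftPow (b : ℝ) (q : ℕ) : Polynomial ℝ := (Polynomial.X - Polynomial.C b) ^ q

theorem eval_iterate_derivative_shiftPow (b : ℝ) (q r : ℕ) (y : ℝ) :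
    (Polynomial.derivative^[r] (shiftPow b q)).eval y = q.descFactorial r * (y - b) ^ (q - r) := by
  rw [shiftPow, Polynomial.iterate_derivative_X_sub_pow]
  simp

theorem eval_iterate_derivative_shiftPow_self (b : ℝ) (q r : ℕ) :
    (Polynomial.derivative^[r] (shiftPow b q)).eval b = if r = q then (q.factorial : ℝ) else 0 := by
  rw [eval_iterate_derivative_shiftPow, sub_self]
  split_ifs with h
  · rw [h, Nat.descFactorial_self]
    simp
  · rcases lt_or_gt_of_ne h with h | h
    · rw [zero_pow (by omega), mul_zero]
    · rw [Nat.descFactorial_of_lt h]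
      simp

/-- The exponent exceeds `i`, so all derivatives of order at most `i` vanish at `a i`; this is the
smoothness that `MemV` asks for there. -/
theorem contDiffAt_truncated_shiftPow (i d : ℕ) {n : ℕ} {x : I} (hx : x = a i → n ≤ i) :
    ContDiffAt ℝ n (truncated (a i) (shiftPow (a i) (i + 1 + d))) x := by
  by_cases h : x = a i
  · rw [h]
    refine contDiffAt_truncated fun r hr => ?_
    rw [eval_iterate_derivative_shiftPow_self, if_neg (by have := hx h; omega)]
  · exact contDiffAt_truncated_of_ne _ (fun h2 => h (Subtype.ext h2)) _

theorem memV_truncated (ha : Function.Injective a) (i d : ℕ) :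
    MemV a fun x : I => truncated (a i) (shiftPow (a i) (i + 1 + d)) x := by
  set D := truncated (a i) (shiftPow (a i) (i + 1 + d)) with hD
  have h : ∀ (n : ℕ) (x : I), (x = a i → n ≤ i) → GermC (fun x : I => D x) n x := fun n x hx =>
    germC_comp_val (contDiffAt_truncated_shiftPow i d hx)
  refine ⟨?_, fun x hx p => h p x fun hi => absurd ⟨i, hi.symm⟩ hx,
    fun p => h p _ fun hi => (ha hi).le, fun x _ p => ?_, fun x _ p => ?_⟩
  · rw [continuous_iff_continuousAt]
    exact fun x => ((contDiffAt_truncated_shiftPow i d (n := 0) fun _ =>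
      Nat.zero_le _).continuousAt).comp continuous_subtype_val.continuousAt
  · by_cases hx : x = a i
    · rw [hx]
      exact ⟨0, (tendsto_iteratedDeriv_truncated_left _ _ p).congr'
        ((der_comp_val_eventuallyEq D p (a i)).symm.filter_mono nhdsWithin_le_nhds)⟩
    · exact ⟨_, tendsto_der_of_germC (h p x fun h => absurd h hx) nhdsWithin_le_nhds⟩
  · by_cases hx : x = a i
    · rw [hx]
      exact ⟨_, (tendsto_iteratedDeriv_truncated_right _ _ p).congr'
        ((der_comp_val_eventuallyEq D p (a i)).symm.filter_mono nhdsWithin_le_nhds)⟩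
    · exact ⟨_, tendsto_der_of_germC (h p x fun h => absurd h hx) nhdsWithin_le_nhds⟩

/-- The truncated power `(x - a_i)_+ ^ (i + 1 + d)`, as an element of `𝓥`. -/
def truncV (ha : Function.Injective a) (i d : ℕ) : V a := (memV_truncated ha i d).toV

theorem der_truncV (ha : Function.Injective a) (i d : ℕ) {r : ℕ} {x : I}
    (hx : ∀ j < r, a j ≠ x) : der (truncV ha i d).fn r x =
      truncated (a i) (Polynomial.derivative^[r] (shiftPow (a i) (i + 1 + d))) x := by
  rw [truncV, MemV.toV_fn, der_comp_val]
  by_cases h : x = a i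
  · have hr : r ≤ i := by
      by_contra! hlt
      exact hx i hlt h.symm
    have hc : ContDiffAt ℝ r (truncated (a i) (shiftPow (a i) (i + 1 + d))) x :=
      contDiffAt_truncated_shiftPow i d fun _ => hr
    rw [h] at hc ⊢
    rw [truncated, if_neg (lt_irrefl _)]
    -- At the knot the derivative is continuous, hence equal to its left limit `0`.
    exact tendsto_nhds_unique ((continuousAt_iteratedDeriv hc).mono_left nhdsWithin_le_nhds)
      (tendsto_iteratedDeriv_truncated_left _ _ r)
  · exact iteratedDeriv_truncated_of_ne _ (fun h2 => h (Subtype.ext h2)) r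

theorem derLeft_truncV (ha : Function.Injective a) (i d r j : ℕ) :
    derLeft (truncV ha i d).fn r (a j) =
      truncated (a i) (Polynomial.derivative^[r] (shiftPow (a i) (i + 1 + d))) (a j) := by
  by_cases h : j = i
  · rw [h, truncated, if_neg (lt_irrefl _)]
    exact derLeft_eq ((tendsto_iteratedDeriv_truncated_left _ _ r).congr'
      ((der_comp_val_eventuallyEq _ r (a i)).symm.filter_mono nhdsWithin_le_nhds))
  · have hne : a j ≠ a i := fun h2 => h (ha h2)
    rw [truncV, MemV.toV_fn, derLeft_of_germC (germC_comp_val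
      (contDiffAt_truncated_shiftPow i d fun h => absurd h hne)), der_comp_val,
      iteratedDeriv_truncated_of_ne _ (fun h2 => hne (Subtype.ext h2)) r]

theorem derRight_truncV_self (ha : Function.Injective a) (i d r : ℕ) :
    derRight (truncV ha i d).fn r (a i) =
      (Polynomial.derivative^[r] (shiftPow (a i) (i + 1 + d))).eval (a i : ℝ) :=
  derRight_eq ((tendsto_iteratedDeriv_truncated_right _ _ r).congr'
    ((der_comp_val_eventuallyEq _ r (a i)).symm.filter_mono nhdsWithin_le_nhds))

theorem derRight_truncV_of_ne (ha : Function.Injective a) {i j : ℕ} (h : j ≠ i) (d r : ℕ) :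
    derRight (truncV ha i d).fn r (a j) = derLeft (truncV ha i d).fn r (a j) := by
  have hne : a j ≠ a i := fun h2 => h (ha h2)
  have hg : GermC (truncV ha i d).fn r (a j) :=
    germC_comp_val (contDiffAt_truncated_shiftPow i d fun h => absurd h hne)
  rw [derRight_of_germC hg, derLeft_of_germC hg]

/-! ### Jumps, and the density of splines. -/

/-- The jump of the `q`-th derivative at `a_i`. -/
def jump (a : ℕ → I) (q i : ℕ) : V a →ₗ[ℝ] ℝ where
  toFun f := derRight f.fn q (a i) - derLeft f.fn q (a i)
  map_add' f g := by rw [derRight_add, derLeft_add]; ring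
  map_smul' c f := by rw [derRight_smul, derLeft_smul, RingHom.id_apply, smul_eq_mul]; ring

theorem jump_apply (q i : ℕ) (f : V a) :
    jump a q i f = derRight f.fn q (a i) - derLeft f.fn q (a i) := rfl

theorem jump_polyV (q i : ℕ) (Q : Polynomial ℝ) : jump a q i (polyV a Q) = 0 := by
  rw [jump_apply, derRight_polyV, derLeft_polyV, sub_self]

/-- Up to factorials, truncated powers and jumps of order `q > i` are dual to each other. This gives
both the removal of jumps and the recovery of coefficients. -/
theorem jump_truncV (ha : Function.Injective a) (q j i d : ℕ) :
    jump a q j (truncV ha i d) = if j = i ∧ q = i + 1 + d then (q.factorial : ℝ) else 0 := by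
  rw [jump_apply]
  by_cases h : j = i
  · subst h
    rw [derRight_truncV_self, derLeft_truncV, truncated, if_neg (lt_irrefl _), sub_zero,
      eval_iterate_derivative_shiftPow_self]
    by_cases hq : q = j + 1 + d
    · simp [hq]
    · simp [hq]
  · rw [derRight_truncV_of_ne ha h, sub_self, if_neg fun h2 => h h2.1]

/-- Splines: combinations of polynomials and of truncated powers. -/
def splines (ha : Function.Injective a) : Submodule ℝ (V a) :=
  Submodule.span ℝ (range (polyV a) ∪ range fun w : ℕ × ℕ => truncV ha w.1 w.2)

theorem polyV_mem_splines (ha : Function.Injective a) (Q : Polynomial ℝ) :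
    polyV a Q ∈ splines ha :=
  Submodule.subset_span (Or.inl ⟨Q, rfl⟩)

theorem truncV_mem_splines (ha : Function.Injective a) (i d : ℕ) : truncV ha i d ∈ splines ha :=
  Submodule.subset_span (Or.inr ⟨(i, d), rfl⟩)

/-- Subtracting a spline, one can remove the jumps of finitely many derivatives. -/
theorem exists_spline_jump_eq (ha : Function.Injective a) (f : V a) (P : ℕ) :
    ∃ s ∈ splines ha, ∀ i q, i < q → q ≤ P → jump a q i (f - s) = 0 := by
  -- A pair `i < q ≤ P` corresponds to `w = (i, q - i - 1)`, which lies in this box. The surplus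
  -- terms only affect jumps of order above `P`.
  refine ⟨∑ w ∈ Finset.range P ×ˢ Finset.range P,
    (jump a (w.1 + 1 + w.2) w.1 f / (w.1 + 1 + w.2).factorial) • truncV ha w.1 w.2,
    Submodule.sum_mem _ fun w _ => Submodule.smul_mem _ _ (truncV_mem_splines ha _ _), ?_⟩
  intro i q hiq hqP
  rw [map_sub, map_sum, sub_eq_zero, Finset.sum_eq_single (i, q - i - 1)]
  · have hq : i + 1 + (q - i - 1) = q := by omega
    simp only [map_smul, jump_truncV, hq, smul_eq_mul]
    rw [if_pos (by simp), div_mul_cancel₀ _ (by positivity)]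
  · rintro ⟨j, d⟩ - hne
    rw [map_smul, jump_truncV, if_neg, smul_zero]
    rintro ⟨rfl, rfl⟩
    exact hne (Prod.ext rfl (by dsimp only; omega))
  · intro h
    refine absurd (Finset.mem_product.2 ⟨?_, ?_⟩) h <;> simp <;> omega

theorem germC_of_jump_eq_zero (f : V a) {P : ℕ}
    (h : ∀ i q, i < q → q ≤ P → jump a q i f = 0) (x : I) : GermC f.fn P x := by
  by_cases hx : ∀ j < P, a j ≠ x
  · exact f.germC hx
  push Not at hx
  obtain ⟨i, hi, rfl⟩ := hx
  refine contDiffAt_of_punctured ?_ ?_ fun q hq => ?_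
  · have := f.germC (q := 0) (x := a i) (by simp)
    exact ContDiffAt.continuousAt this
  · filter_upwards [eventually_avoid a P (a i)] with y ⟨z, hz, hj⟩
    exact hz ▸ f.germC hj
  · rw [← nhdsLT_sup_nhdsGT]
    rcases le_or_gt q i with hqi | hqi
    · have hg : GermC f.fn q (a i) := ContDiffAt.of_le (f.mem.contDiff i) (by exact_mod_cast hqi)
      exact ⟨_, (tendsto_der_of_germC hg nhdsWithin_le_nhds).sup
        (tendsto_der_of_germC hg nhdsWithin_le_nhds)⟩
    · refine ⟨_, (f.tendsto_derLeft q i).sup ?_⟩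
      rw [← sub_eq_zero.1 (h i q hqi hq)]
      exact f.tendsto_derRight q i

theorem dense_splines (ha : Function.Injective a) : Dense (splines ha : Set (V a)) := by
  intro f
  rw [mem_closure_iff_nhds]
  intro U hU
  obtain ⟨m, ε, hε, hm⟩ := mem_nhds_V_iff.1 hU
  obtain ⟨s, hs, hjump⟩ := exists_spline_jump_eq ha f m
  have hg := germC_of_jump_eq_zero (f - s) hjump
  obtain ⟨α, β, hαβ, hα, hβ, hK⟩ : ∃ α β : ℝ, α ≤ β ∧ -1 < α ∧ β < 1 ∧
      ∀ x ∈ exhaustion m, (x : ℝ) ∈ Icc α β := by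
    -- Inserting `0` keeps the set nonempty, so that it has a least and a greatest element.
    have hc : IsCompact (insert 0 ((↑) '' exhaustion m : Set ℝ)) :=
      ((exhaustion.isCompact m).image continuous_subtype_val).insert 0
    have hsub : insert 0 ((↑) '' exhaustion m : Set ℝ) ⊆ Ioo (-1) 1 := by
      rintro _ (rfl | ⟨x, -, rfl⟩)
      · simp
      · exact x.2
    obtain ⟨α, hα, hα2⟩ := hc.exists_isLeast (insert_nonempty _ _)
    obtain ⟨β, hβ, hβ2⟩ := hc.exists_isGreatest (insert_nonempty _ _)
    exact ⟨α, β, hα2 hβ, (hsub hα).1, (hsub hβ).2, fun x hx =>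
      ⟨hα2 (Or.inr ⟨x, hx, rfl⟩), hβ2 (Or.inr ⟨x, hx, rfl⟩)⟩⟩
  obtain ⟨Q, hQ⟩ := exists_polynomial_near_iteratedDeriv (P := m) (F := NowhereSmooth.ext (f - s).fn)
    hαβ (fun x hx => hg ⟨x, by linarith [hx.1], by linarith [hx.2]⟩) (half_pos hε)
  refine ⟨polyV a Q + s, hm _ (lt_of_le_of_lt (seminormV_le (half_pos hε).le ?_)
    (half_lt_self hε)), Submodule.add_mem _ (polyV_mem_splines ha Q) hs⟩
  intro x hxK hxa q hq
  have hgx : GermC (f - s).fn q x := ContDiffAt.of_le (hg x) (by exact_mod_cast hq)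
  rw [show polyV a Q + s - f = polyV a Q - (f - s) by abel, V.fn_sub,
    der_sub (germC_polyV Q q x) hgx, der_polyV]
  exact (hQ q hq x (hK x hxK)).le

/-! ### Fields of definition of splines. -/

/-- The derivatives of `f`, and their one-sided limits, are rational over `F`. -/
structure RationalOver (F : Subfield ℝ) (f : V a) : Prop where
  -- The larger field `G` allows evaluation at points outside `F`, such as the `x i` adjoined along
  -- with the jet.
  der_mem : ∀ G : Subfield ℝ, F ≤ G → ∀ (x : I) (r : ℕ), (∀ j < r, a j ≠ x) → (x : ℝ) ∈ G →
    der f.fn r x ∈ G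
  left_mem : ∀ r i, derLeft f.fn r (a i) ∈ F
  right_mem : ∀ r i, derRight f.fn r (a i) ∈ F

theorem RationalOver.mono {F G : Subfield ℝ} {f : V a} (hf : RationalOver F f) (h : F ≤ G) :
    RationalOver G f :=
  ⟨fun H hH => hf.der_mem H (h.trans hH), fun r i => h (hf.left_mem r i),
    fun r i => h (hf.right_mem r i)⟩

theorem RationalOver.add {F : Subfield ℝ} {f g : V a} (hf : RationalOver F f)
    (hg : RationalOver F g) : RationalOver F (f + g) := by
  refine ⟨fun G hG x r hx hxG => ?_, fun r i => ?_, fun r i => ?_⟩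
  · rw [V.fn_add, der_add (f.germC hx) (g.germC hx)]
    exact add_mem (hf.der_mem G hG x r hx hxG) (hg.der_mem G hG x r hx hxG)
  · rw [derLeft_add]
    exact add_mem (hf.left_mem r i) (hg.left_mem r i)
  · rw [derRight_add]
    exact add_mem (hf.right_mem r i) (hg.right_mem r i)

theorem RationalOver.smul {F : Subfield ℝ} {f : V a} (hf : RationalOver F f) {c : ℝ} (hc : c ∈ F) :
    RationalOver F (c • f) := by
  refine ⟨fun G hG x r hx hxG => ?_, fun r i => ?_, fun r i => ?_⟩
  · rw [V.fn_smul, der_smul]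
    exact mul_mem (hG hc) (hf.der_mem G hG x r hx hxG)
  · rw [derLeft_smul]
    exact mul_mem hc (hf.left_mem r i)
  · rw [derRight_smul]
    exact mul_mem hc (hf.right_mem r i)

theorem eval_iterate_derivative_mem {F : Subfield ℝ} {Q : Polynomial ℝ} (hQ : ∀ j, Q.coeff j ∈ F)
    {y : ℝ} (hy : y ∈ F) (r : ℕ) : (Polynomial.derivative^[r] Q).eval y ∈ F := by
  rw [Polynomial.eval_eq_sum]
  refine sum_mem fun j _ => mul_mem ?_ (pow_mem hy j)
  rw [Polynomial.coeff_iterate_derivative]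
  exact nsmul_mem (hQ _) _

theorem rationalOver_polyV {F : Subfield ℝ} (haF : ∀ i, (a i : ℝ) ∈ F) {Q : Polynomial ℝ}
    (hQ : ∀ j, Q.coeff j ∈ F) : RationalOver F (polyV a Q) := by
  refine ⟨fun G hG x r hx hxG => ?_, fun r i => ?_, fun r i => ?_⟩
  · rw [der_polyV]
    exact eval_iterate_derivative_mem (fun j => hG (hQ j)) hxG r
  · rw [derLeft_polyV]
    exact eval_iterate_derivative_mem hQ (haF i) r
  · rw [derRight_polyV]
    exact eval_iterate_derivative_mem hQ (haF i) r

theorem rationalOver_truncV (ha : Function.Injective a) {F : Subfield ℝ}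
    (haF : ∀ i, (a i : ℝ) ∈ F) (i d : ℕ) : RationalOver F (truncV ha i d) := by
  have hs : ∀ G : Subfield ℝ, F ≤ G → ∀ y ∈ G, ∀ r,
      (Polynomial.derivative^[r] (shiftPow (a i) (i + 1 + d))).eval y ∈ G := fun G hG y hy r => by
    rw [eval_iterate_derivative_shiftPow]
    exact mul_mem (natCast_mem G _) (pow_mem (sub_mem hy (hG (haF i))) _)
  have ht : ∀ G : Subfield ℝ, F ≤ G → ∀ y ∈ G, ∀ r,
      truncated (a i) (Polynomial.derivative^[r] (shiftPow (a i) (i + 1 + d))) y ∈ G :=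
    fun G hG y hy r => by
      rw [truncated]
      split_ifs
      · exact hs G hG y hy r
      · exact zero_mem G
  refine ⟨fun G hG x r hx hxG => ?_, fun r j => ?_, fun r j => ?_⟩
  · rw [der_truncV ha i d hx]
    exact ht G hG x hxG r
  · rw [derLeft_truncV]
    exact ht F le_rfl _ (haF j) r
  · by_cases h : j = i
    · rw [h, derRight_truncV_self]
      exact hs F le_rfl _ (haF i) r
    · rw [derRight_truncV_of_ne ha h, derLeft_truncV]
      exact ht F le_rfl _ (haF j) r

theorem RationalOver.sum {F : Subfield ℝ} (haF : ∀ i, (a i : ℝ) ∈ F) {ι : Type*} (s : Finset ι)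
    {f : ι → V a} (hf : ∀ j ∈ s, RationalOver F (f j)) : RationalOver F (∑ j ∈ s, f j) := by
  refine Finset.sum_induction f _ (fun _ _ => RationalOver.add) ?_ hf
  have := (rationalOver_polyV haF (Q := 0) (by simp)).smul (c := 0) (zero_mem F)
  rwa [zero_smul] at this

/-- Splines are rational over a field generated by countably many elements. -/
theorem exists_rationalOver_of_mem_splines (ha : Function.Injective a) {f : V a}
    (hf : f ∈ splines ha) : ∃ s : Set ℝ, s.Countable ∧ (∀ i, (a i : ℝ) ∈ Subfield.closure s) ∧
      RationalOver (Subfield.closure s) f := by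
  have hA : ∀ s : Set ℝ, ∀ i, (a i : ℝ) ∈ Subfield.closure (s ∪ range fun i => (a i : ℝ)) :=
    fun s i => Subfield.subset_closure (Or.inr ⟨i, rfl⟩)
  have hAc : (range fun i => (a i : ℝ)).Countable := countable_range _
  have hpoly : ∀ Q : Polynomial ℝ, RationalOver
      (Subfield.closure (range Q.coeff ∪ range fun i => (a i : ℝ))) (polyV a Q) := fun Q =>
    rationalOver_polyV (hA _) fun j => Subfield.subset_closure (Or.inl ⟨j, rfl⟩)
  suffices h : ∃ s : Set ℝ, s.Countable ∧
      RationalOver (Subfield.closure (s ∪ range fun i => (a i : ℝ))) f by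
    obtain ⟨s, hs, h⟩ := h
    exact ⟨_, hs.union hAc, hA s, h⟩
  induction hf using Submodule.span_induction with
  | mem f hf =>
    rcases hf with ⟨Q, rfl⟩ | ⟨w, rfl⟩
    · exact ⟨range Q.coeff, countable_range _, hpoly Q⟩
    · exact ⟨∅, countable_empty, rationalOver_truncV ha (hA ∅) _ _⟩
  | zero =>
    refine ⟨∅, countable_empty, ?_⟩
    have := RationalOver.sum (hA ∅) (∅ : Finset ℕ) (f := fun _ => (0 : V a)) (by simp)
    rwa [Finset.sum_empty] at this
  | add f g _ _ hf hg =>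
    obtain ⟨s, hs, hf⟩ := hf
    obtain ⟨t, ht, hg⟩ := hg
    refine ⟨s ∪ t, hs.union ht, (hf.mono ?_).add (hg.mono ?_)⟩ <;>
    refine Subfield.closure_mono (union_subset_union_left _ ?_)
    exacts [subset_union_left, subset_union_right]
  | smul c f _ hf =>
    obtain ⟨s, hs, hf⟩ := hf
    refine ⟨insert c s, hs.insert c, (hf.mono ?_).smul (Subfield.subset_closure (by simp))⟩
    exact Subfield.closure_mono (union_subset_union_left _ (subset_insert c s))

theorem countable_closure {s : Set ℝ} (hs : s.Countable) : Countable (Subfield.closure s) := by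
  rw [← Cardinal.mk_le_aleph0_iff]
  refine (Subfield.cardinalMk_closure_le_max s).trans ?_
  rw [max_le_iff]
  exact ⟨Cardinal.mk_le_aleph0_iff.2 hs.to_subtype, le_rfl⟩

/-! ### Perturbation by splines with independent coefficients. -/

/-- The embedding of the polynomials into `𝓥`, as a linear map. -/
def polyVₗ (a : ℕ → I) : Polynomial ℝ →ₗ[ℝ] V a where
  toFun := polyV a
  map_add' _ _ := V.ext fun _ => Polynomial.eval_add
  map_smul' _ _ := V.ext fun _ => Polynomial.eval_smul _ _ _

theorem polyVₗ_apply (Q : Polynomial ℝ) : polyVₗ a Q = polyV a Q := rfl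

/-- The index set of a family of splines whose jets are linearly independent. -/
abbrev SplineIndex (n p k : ℕ) : Type :=
  -- The first summand counts Hermite data of order `p` at `n + k + 1` nodes. In the second, `d < p
  -- - i` means that the exponent `i + 1 + d` runs from `i + 1` to `p`.
  Fin ((n + (k + 1)) * (p + 1)) ⊕ (Σ i : Fin (k + 1), Fin (p - i))

/-- Powers and truncated powers. -/
def splineBasis (ha : Function.Injective a) (n p k : ℕ) : SplineIndex n p k → V a :=
  Sum.elim (fun j => polyV a (Polynomial.X ^ (j : ℕ))) fun w => truncV ha w.1 w.2

/-- The coefficients of a linear combination of powers and truncated powers are rational over any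
field over which its jets are rational. -/
theorem coeff_mem_of_jetFun_mem (ha : Function.Injective a) {n p k : ℕ} (hkp : k ≤ p) {G : Subfield ℝ}
    (haG : ∀ i, (a i : ℝ) ∈ G) {g : V a} (hg : RationalOver G g) {x : Fin n → I}
    (hx : x ∈ admissible a n p) (c : SplineIndex n p k → ℝ)
    (hG : ∀ w, jetFun (g + ∑ j, c j • splineBasis ha n p k j) p k x w ∈ G) (j) : c j ∈ G := by
  set f := g + ∑ j, c j • splineBasis ha n p k j with hf
  have hxG : ∀ i, (x i : ℝ) ∈ G := fun i => hG (Sum.inl i)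
  have hder : ∀ i (r : Fin (p + 1)), der f.fn r (x i) ∈ G := fun i r => hG (Sum.inr (Sum.inl (i, r)))
  have hleft : ∀ (i : Fin (k + 1)) (r : Fin (p + 1)), derLeft f.fn r (a i) ∈ G :=
    fun i r => hG (Sum.inr (Sum.inr (Sum.inl (i, r))))
  have hright : ∀ (i : Fin (k + 1)) (r : Fin (p + 1)), derRight f.fn r (a i) ∈ G :=
    fun i r => hG (Sum.inr (Sum.inr (Sum.inr (i, r))))
  set Q : Polynomial ℝ := ∑ j : Fin ((n + (k + 1)) * (p + 1)),
    Polynomial.C (c (Sum.inl j)) * Polynomial.X ^ (j : ℕ) with hQ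
  set e := ∑ w : (Σ i : Fin (k + 1), Fin (p - i)), c (Sum.inr w) • truncV ha w.1 w.2 with he
  have hfsum : f = polyV a Q + (g + e) := by
    have : polyV a Q = ∑ j : Fin ((n + (k + 1)) * (p + 1)),
        c (Sum.inl j) • polyV a (Polynomial.X ^ (j : ℕ)) := by
      simp only [← polyVₗ_apply, hQ, map_sum, Polynomial.C_mul', map_smul]
    rw [hf, this, Fintype.sum_sum_type, he]
    simp only [splineBasis, Sum.elim_inl, Sum.elim_inr]
    abel
  -- The jump of order `i + 1 + d` at `a i` isolates one coefficient, since polynomials have no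
  -- jumps and the jumps of `g` lie in `G`.
  have hc2 : ∀ w, c (Sum.inr w) ∈ G := by
    rintro ⟨i, d⟩
    have hq : (i : ℕ) + 1 + d < p + 1 := by have := d.2; omega
    have h1 : jump a (i + 1 + d) i f ∈ G := sub_mem (hright i ⟨_, hq⟩) (hleft i ⟨_, hq⟩)
    have h2 : jump a (i + 1 + d) i g ∈ G := sub_mem (hg.right_mem _ _) (hg.left_mem _ _)
    have h3 : jump a (i + 1 + d) i e = c (Sum.inr ⟨i, d⟩) * ((i : ℕ) + 1 + d).factorial := by
      rw [he, map_sum, Finset.sum_eq_single ⟨i, d⟩]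
      · rw [map_smul, jump_truncV, if_pos ⟨rfl, rfl⟩, smul_eq_mul]
      · rintro ⟨i', d'⟩ - hne
        rw [map_smul, jump_truncV, if_neg, smul_zero]
        rintro ⟨h1, h2⟩
        dsimp only at h1 h2
        obtain rfl : i = i' := Fin.ext h1
        obtain rfl : d = d' := Fin.ext (by omega)
        exact hne rfl
      · exact fun h => absurd (Finset.mem_univ _) h
    rw [hfsum, map_add, map_add, jump_polyV, zero_add, h3] at h1
    have h4 := div_mem ((add_mem_cancel_left h2).1 h1) (natCast_mem G ((i : ℕ) + 1 + d).factorial)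
    rwa [mul_div_cancel_right₀ _ (by positivity)] at h4
  have hge : RationalOver G (g + e) :=
    hg.add (RationalOver.sum haG _ fun w _ => (rationalOver_truncV ha haG _ _).smul (hc2 w))
  have hQcoeff : ∀ j : Fin ((n + (k + 1)) * (p + 1)), Q.coeff j = c (Sum.inl j) := by
    intro j
    rw [hQ, Polynomial.finsetSum_coeff, Finset.sum_eq_single j]
    · simp
    · intro j' _ hne
      simp [Polynomial.coeff_X_pow, Fin.val_ne_of_ne hne.symm]
    · exact fun h => absurd (Finset.mem_univ _) h
  rcases j with j | w
  swap
  · exact hc2 w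
  rw [← hQcoeff]
  -- Now `g + e` is rational over `G`. Subtracting it leaves the derivatives of `Q` at all nodes,
  -- with left limits standing in for derivatives at the `a i`.
  refine coeff_mem_of_iterate_derivative_mem G (ι := Fin n ⊕ Fin (k + 1)) (p := p)
    (u := Sum.elim (fun i => (x i : ℝ)) fun i => (a i : ℝ)) ?_ ?_ ?_ ?_ j
  · refine Function.Injective.sumElim (fun i i' h => hx.1 (Subtype.ext h))
      (fun i i' h => Fin.ext (ha (Subtype.ext h))) fun i i' h => ?_
    exact hx.2 i i' (by have := i'.2; omega) (Subtype.ext h.symm)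
  · rintro (i | i)
    exacts [hxG i, haG i]
  · rw [Fintype.card_sum, Fintype.card_fin, Fintype.card_fin]
    refine Submodule.sum_mem _ fun j _ => ?_
    rw [Polynomial.mem_degreeLT]
    exact (Polynomial.degree_C_mul_X_pow_le _ _).trans_lt (by exact_mod_cast j.2)
  · rintro (i | i) r hr
    · have hav : ∀ j < r, a j ≠ x i := fun j hj => hx.2 i j (by omega)
      have h1 := hder i ⟨r, Nat.lt_succ_of_le hr⟩
      have h2 := hge.der_mem G le_rfl (x i) r hav (hxG i)
      dsimp only at h1
      rw [hfsum, V.fn_add, der_add (germC_polyV Q r _) (V.germC _ hav), der_polyV] at h1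
      exact (add_mem_cancel_right h2).1 h1
    · have h1 := hleft i ⟨r, Nat.lt_succ_of_le hr⟩
      dsimp only at h1
      rw [hfsum, derLeft_add, derLeft_polyV] at h1
      exact (add_mem_cancel_right (hge.left_mem r i)).1 h1

/-- The perturbation is chosen before `x`: independence of `c` over the countable field of `g`
forces enough independent jet entries at every admissible tuple. -/
theorem dense_jetAvoiding (ha : Function.Injective a) {n p k : ℕ} (hkp : k ≤ p) (m : ℕ)
    (P : (SplineIndex n p k → JetIndex n p k) → MvPolynomial (SplineIndex n p k) ℚ) :
    Dense (jetAvoiding a n p k m P) := by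
  rw [dense_iff_inter_open]
  rintro U hU hne
  obtain ⟨g, hgU, hg⟩ := (dense_splines ha).inter_open_nonempty U hU hne
  obtain ⟨s, hs, hsa, hgs⟩ := exists_rationalOver_of_mem_splines ha hg
  have hcount := countable_closure hs
  set Φ : (SplineIndex n p k → ℝ) → V a := fun c => g + ∑ j, c j • splineBasis ha n p k j with hΦ
  have hΦc : Continuous Φ := continuous_const.add (continuous_finsetSum _ fun j _ =>
    (continuous_apply j).smul continuous_const)
  obtain ⟨c, hcU, hc⟩ := (dense_algebraicIndependent (Subfield.closure s)
    (SplineIndex n p k)).inter_open_nonempty (Φ ⁻¹' U) (hU.preimage hΦc) ⟨0, by simpa [hΦ] using hgU⟩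
  refine ⟨Φ c, hcU, fun x _ => ?_⟩
  set G := (IntermediateField.adjoin (Subfield.closure s) (range (jetFun (Φ c) p k x.1))).toSubfield
    with hG
  have hle : Subfield.closure s ≤ G := fun y hy => IntermediateField.algebraMap_mem _
    (⟨y, hy⟩ : Subfield.closure s)
  obtain ⟨t, ht⟩ := exists_algebraicIndependent_comp (Subfield.closure s)
    (z := jetFun (Φ c) p k x.1) hc fun j => coeff_mem_of_jetFun_mem (G := G) ha hkp
      (fun i => hle (hsa i)) (hgs.mono hle) x.2 c
      (fun w => IntermediateField.subset_adjoin _ _ ⟨w, rfl⟩) j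
  refine ⟨t, ?_⟩
  by_cases h0 : P t = 0
  · exact Or.inl h0
  · exact Or.inr fun h => h0 ((algebraicIndependent_iff.1 ht) _ h)

/-! ### Counting, and the residual set. -/

/-- In fact an equality: `∑ (p - i)` and `∑ (i + 1)` over `i ≤ k` add up to `(k + 1) * (p + 1)`, and
the second sum is `(k + 1) * (k + 2) / 2`. -/
theorem le_card_splineIndex {n p k : ℕ} (hkp : k ≤ p) :
    n * (p + 2) + (k + 1) * (2 * p + 3) ≤
      Fintype.card (SplineIndex n p k) + ((k + 1) * (k + 2) / 2 + (n + k + 1)) := by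
  have h1 : Fintype.card (SplineIndex n p k) =
      (n + (k + 1)) * (p + 1) + ∑ i ∈ Finset.range (k + 1), (p - i) := by
    simp [SplineIndex, Fintype.card_sigma, Finset.sum_range]
  have h2 : ∑ i ∈ Finset.range (k + 1), (p - i) + ∑ i ∈ Finset.range (k + 1), (i + 1) =
      (k + 1) * (p + 1) := by
    rw [← Finset.sum_add_distrib, Finset.sum_congr rfl (g := fun _ => p + 1) fun i hi => ?_]
    · simp
    · have := Finset.mem_range.1 hi
      omega
  have h3 : ∑ i ∈ Finset.range (k + 1), (i + 1) = (k + 1) * (k + 2) / 2 := by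
    have := Finset.sum_range_succ' (fun i => i) (k + 1)
    rw [add_zero] at this
    rw [← this, Finset.sum_range_id]
    congr 1
    rw [Nat.add_sub_cancel]
    ring
  rw [h1, ← h3]
  nlinarith

theorem trdegBound_of_jetAvoiding (ha : Function.Injective a) {f : V a} {n k : ℕ}
    (hf : ∀ p, k ≤ p → ∀ m P, f ∈ jetAvoiding a n p k m (κ := SplineIndex n p k) P)
    {x : Fin n → I} (hxa : ∀ i, x i ∉ range a) (hx : Function.Injective x) :
    TrdegBound f n k x (n + k + 1) := by
  intro p hkp
  obtain ⟨s, hs⟩ := exists_algebraicIndependent_of_jetAvoiding (hf p hkp) (x := x)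
    ⟨hx, fun i j _ h => hxa i ⟨j, h⟩⟩
  have h1 := mk_le_trdegQ hs fun j => range_jetFun_subset ha f x ⟨s j, rfl⟩
  rw [Cardinal.mk_fintype] at h1
  refine le_trans ?_ (add_le_add_left h1 _)
  exact_mod_cast le_card_splineIndex hkp

theorem exists_residual_trdegBound (ha : Function.Injective a) :
    ∃ R : Set (V a), IsResidualSet R ∧ ∀ f ∈ R, ∀ (n k : ℕ) (x : Fin n → I),
      (∀ i, x i ∉ range a) → Function.Injective x → TrdegBound f n k x (n + k + 1) := by
  have hc : ∀ n p k : ℕ, Countable (MvPolynomial (SplineIndex n p k) ℚ) := fun n p k =>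
    countable_mvPolynomial _ _
  -- The quadruple is `(n, k, d, m)` with `p = k + d`, so that `k ≤ p` holds for every index.
  obtain ⟨e, he⟩ := exists_surjective_nat (Σ w : ℕ × ℕ × ℕ × ℕ,
    ((SplineIndex w.1 (w.2.1 + w.2.2.1) w.2.1 → JetIndex w.1 (w.2.1 + w.2.2.1) w.2.1) →
      MvPolynomial (SplineIndex w.1 (w.2.1 + w.2.2.1) w.2.1) ℚ))
  refine ⟨_, ⟨fun j => jetAvoiding a (e j).1.1 ((e j).1.2.1 + (e j).1.2.2.1) (e j).1.2.1
    (e j).1.2.2.2 (e j).2, fun j => ⟨isOpen_jetAvoiding _ _ _ _ _,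
      dense_jetAvoiding ha (Nat.le_add_right _ _) _ _⟩, rfl⟩, ?_⟩
  intro f hf n k x hxa hx
  refine trdegBound_of_jetAvoiding ha (fun p hkp m P => ?_) hxa hx
  obtain ⟨d, rfl⟩ := Nat.exists_eq_add_of_le hkp
  obtain ⟨j, hj⟩ := he ⟨(n, k, d, m), P⟩
  have := mem_iInter.1 hf j
  rwa [hj] at this

theorem dense_of_isResidualSet (ha : Function.Injective a) {R : Set (V a)} (hR : IsResidualSet R) :
    Dense R := by
  have := completeSpace_V ha
  let _ := UniformSpace.pseudoMetricSpace (V a)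
  obtain ⟨U, hU, rfl⟩ := hR
  exact dense_iInter_of_isOpen_nat (fun m => (hU m).1) fun m => (hU m).2

/-! ### Failure of smoothness. -/

theorem StronglyTranscendental.not_germWeaklySmooth {f : V a} (hf : StronglyTranscendental f)
    (k : ℕ) : ¬ GermWeaklySmooth f.fn (a k) := by
  intro hk
  obtain ⟨C, hC⟩ := hf 0 k Fin.elim0 (fun i => i.elim0) (fun i => i.elim0)
  -- With `n = 0` the bound is compared with `(k + 1) + (2 * k + 1) * (p + 1)` entries, because left
  -- and right limits at `a k` coincide. This would give `p + 1 ≤ (k + 1) * (k + 2) / 2 + C`, which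
  -- the chosen `p` violates.
  set p := k + ((k + 1) * (k + 2) / 2 + C) with hp
  have h := hC p (Nat.le_add_right _ _)
  let z : Fin (k + 1) ⊕ (Fin (k + 1) × Fin (p + 1)) ⊕ (Fin k × Fin (p + 1)) → ℝ :=
    Sum.elim (fun i => a i) <| Sum.elim
      (fun w => if (w.2 : ℕ) ≤ w.1 then der f.fn w.2 (a w.1) else derLeft f.fn w.2 (a w.1))
      fun w => derRight f.fn w.2 (a w.1)
  have hz : fullJet f 0 p k Fin.elim0 ⊆ range z := by
    rintro y ((⟨i, _⟩ | ⟨i, hi, rfl⟩) | ((⟨i, _⟩ | ⟨i, hi, q, hq, rfl⟩) |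
      ⟨i, hi, q, hiq, hq, rfl | rfl⟩))
    · exact i.elim0
    · exact ⟨Sum.inl ⟨i, by omega⟩, rfl⟩
    · exact i.elim0
    · exact ⟨Sum.inr (Sum.inl (⟨i, by omega⟩, ⟨q, by omega⟩)), if_pos hq⟩
    · exact ⟨Sum.inr (Sum.inl (⟨i, by omega⟩, ⟨q, by omega⟩)), if_neg hiq.not_ge⟩
    · rcases hi.lt_or_eq with h | rfl
      · exact ⟨Sum.inr (Sum.inr (⟨i, h⟩, ⟨q, by omega⟩)), rfl⟩
      · refine ⟨Sum.inr (Sum.inl (⟨i, by omega⟩, ⟨q, by omega⟩)), (if_neg hiq.not_ge).trans ?_⟩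
        rw [derRight_of_germC (hk q)]
        exact derLeft_of_germC (hk q)
  have h2 := h.trans (add_le_add_left (trdegQ_le_card hz) _)
  have h3 : 0 * (p + 2) + (k + 1) * (2 * p + 3) ≤
      (k + 1 + ((k + 1) * (p + 1) + k * (p + 1))) + ((k + 1) * (k + 2) / 2 + C) := by
    simp only [Fintype.card_sum, Fintype.card_prod, Fintype.card_fin] at h2
    exact_mod_cast h2
  nlinarith

theorem isNowhereSmooth_of_not_germWeaklySmooth (hdense : DenseRange a) {f : I → ℝ}
    (hf : ∀ i, ¬ GermWeaklySmooth f (a i)) : IsNowhereSmooth f := by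
  intro U hU hne hsub hsm
  obtain ⟨y, hy⟩ := hne
  obtain ⟨i, hi⟩ := hdense.exists_mem_open (hU.preimage continuous_subtype_val)
    ⟨(⟨y, hsub hy⟩ : I), hy⟩
  exact hf i fun p => (hsm.contDiffAt (hU.mem_nhds hi)).of_le (by exact_mod_cast le_top)

end NowhereSmooth

end

theorem mainTheorem4 (a : ℕ → NowhereSmooth.I) (ha : Function.Injective a)
    (hdense : DenseRange a) :
    -- the space is a complete metrisable locally convex space
    (CompleteSpace (NowhereSmooth.V a) ∧
      TopologicalSpace.MetrizableSpace (NowhereSmooth.V a) ∧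
      LocallyConvexSpace ℝ (NowhereSmooth.V a)) ∧
    -- strongly transcendental functions are dense
    Dense {f : NowhereSmooth.V a | NowhereSmooth.StronglyTranscendental f} ∧
    -- they contain a residual set, on which the constant may be taken to be `n + k + 1`
    (∃ R : Set (NowhereSmooth.V a), NowhereSmooth.IsResidualSet R ∧
      R ⊆ {f | NowhereSmooth.StronglyTranscendental f} ∧
      ∀ f ∈ R, ∀ (n k : ℕ) (x : Fin n → NowhereSmooth.I),
        (∀ i, x i ∉ Set.range a) → Function.Injective x →
          NowhereSmooth.TrdegBound f n k x (n + k + 1)) ∧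
    -- strongly transcendental functions are nowhere smooth
    (∀ f : NowhereSmooth.V a, NowhereSmooth.StronglyTranscendental f →
      (∀ i, ¬ NowhereSmooth.GermWeaklySmooth f.fn (a i)) ∧
      NowhereSmooth.IsNowhereSmooth f.fn) := by
  obtain ⟨R, hR, hbound⟩ := NowhereSmooth.exists_residual_trdegBound ha
  have hsub : R ⊆ {f | NowhereSmooth.StronglyTranscendental f} := fun f hf n k x hxa hx =>
    ⟨n + k + 1, hbound f hf n k x hxa hx⟩
  refine ⟨⟨NowhereSmooth.completeSpace_V ha, NowhereSmooth.metrizableSpace_V a,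
    NowhereSmooth.locallyConvexSpace_V a⟩, (NowhereSmooth.dense_of_isResidualSet ha hR).mono hsub,
    ⟨R, hR, hsub, hbound⟩, fun f hf => ⟨hf.not_germWeaklySmooth,
    NowhereSmooth.isNowhereSmooth_of_not_germWeaklySmooth hdense hf.not_germWeaklySmooth⟩⟩
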